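/- For $\theta\in(-\pi,\pi]$ put $\gamma=e^{i\theta/2}$ and let $$\mathfrak L_\theta=\left\{\begin{pmatrix}a&b&\gamma c&d\\ b&a&d&\bar\gamma c\\ \bar\gamma c&d&a&b\\ d&\gamma c&b&a\end{pmatrix}: a,b,c,d\in\mathbb C\right\}\subset M_4(\mathbb C).$$ A quantum channel is a completely positive trace-preserving linear map $\Phi$ from operators on $\mathcal H_A$ to operators on $\mathcal H_B$ (finite-dimensional Hilbert spaces). If $\Phi(\rho)=\mathrm{Tr}_E\,V\rho V^*$ with an isometry $V:\mathcal H_A\to\mathcal H_B\otimes\mathcal H_E$, its complementary channel is $\widehat\Phi(\rho)=\mathrm{Tr}_B\,V\rho V^*$, and its noncommutative graph is the subspace $\widehat\Phi^*(B(\mathcal H_E))$ of $B(\mathcal H_A)$, which does not depend on the choice of $V$. A subspace $\mathcal H_0\subseteq\mathcal H_A$ is an error correcting code for $\Phi$ if there is a channel $\Theta$ with $\Theta(\Phi(\rho))=\rho$ for all states $\rho$ supported by $\mathcal H_0$. The 1-shot quantum zero-error capacity is $\bar Q_0(\Phi)=\sup\log_2\dim\mathcal H_0$ over all nonzero error correcting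 codes $\mathcal H_0$ for $\Phi$, and the quantum zero-error capacity is $Q_0(\Phi)=\sup_{k\ge1}k^{-1}\bar Q_0(\Phi^{\otimes k})$. Let $n\ge1$ be arbitrary and let $m\ge1$ be a natural number such that $\theta_*=\pi/m\le 2\ln(3/2)/n$. Then there exist channels with input space $\mathbb C^4$ whose noncommutative graph is $\mathfrak L_{\theta_*}$, and for every such channel $\Phi_{\theta_*}$ $$\bar Q_0(\Phi_{\theta_*}^{\otimes n})=0,\qquad\text{but}\qquad \bar Q_0(\Phi_{\theta_*}^{\otimes m})\ge1,\qquad\text{and hence}\qquad Q_0(\Phi_{\theta_*})\ge 1/m.$$ Moreover, there exist $2^m$ mutually orthogonal two-dimensional error correcting codes for the channel $\Phi_{\theta_*}^{\otimes m}$. -/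

import Mathlib

open scoped ENNReal Matrix ComplexOrder

namespace ZeroError

/-- Linear maps from operators on `ℂ^A` to operators on `ℂ^B` (finite index types `A`, `B`). -/
abbrev MatMap (A B : Type*) := Matrix A A ℂ →ₗ[ℂ] Matrix B B ℂ

section Channels

variable {A B E : Type*}

/-- The map `id_k ⊗ Φ`, applied block by block to a `k × k` block matrix over `Matrix A A ℂ`. -/
def ampliation (k : ℕ) (Φ : MatMap A B) (X : Matrix (Fin k × A) (Fin k × A) ℂ) :
    Matrix (Fin k × B) (Fin k × B) ℂ :=
  Matrix.of fun p q => Φ (Matrix.of fun a a' => X (p.1, a) (q.1, a')) p.2 q.2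

/-- Quantum channel: a completely positive trace-preserving linear map. -/
structure IsChannel [Fintype A] [Fintype B] (Φ : MatMap A B) : Prop where
  completelyPositive : ∀ (k : ℕ) (X : Matrix (Fin k × A) (Fin k × A) ℂ),
    X.PosSemidef → (ampliation k Φ X).PosSemidef
  tracePreserving : ∀ X : Matrix A A ℂ, (Φ X).trace = X.trace

/-- Partial trace over the second factor `ℂ^E` of `ℂ^B ⊗ ℂ^E`. -/
def traceSnd [Fintype E] : MatMap (B × E) B where
  toFun X := Matrix.of fun b b' => ∑ e, X (b, e) (b', e)
  map_add' X Y := by ext; simp [Finset.sum_add_distrib]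
  map_smul' c X := by ext; simp [Finset.mul_sum]

/-- Partial trace over the first factor `ℂ^B` of `ℂ^B ⊗ ℂ^E`. -/
def traceFst [Fintype B] : MatMap (B × E) E where
  toFun X := Matrix.of fun e e' => ∑ b, X (b, e) (b, e')
  map_add' X Y := by ext; simp [Finset.sum_add_distrib]
  map_smul' c X := by ext; simp [Finset.mul_sum]

/-- The map `X ↦ V X V*`. -/
def conjugation [Fintype A] (V : Matrix B A ℂ) : MatMap A B where
  toFun X := V * X * Vᴴ
  map_add' X Y := by simp [Matrix.mul_add, Matrix.add_mul]
  map_smul' c X := by simp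

/-- `V : ℂ^A → ℂ^B ⊗ ℂ^E` is a Stinespring isometry of `Φ`:
`V* V = 1` and `Φ ρ = Tr_E (V ρ V*)`. -/
def IsStinespring [Fintype A] [DecidableEq A] [Fintype B] [Fintype E]
    (Φ : MatMap A B) (V : Matrix (B × E) A ℂ) : Prop :=
  Vᴴ * V = 1 ∧ Φ = traceSnd ∘ₗ conjugation V

/-- The complementary channel `ρ ↦ Tr_B (V ρ V*)` given by a Stinespring isometry `V`. -/
def complementary [Fintype A] [Fintype B] (V : Matrix (B × E) A ℂ) : MatMap A E :=
  traceFst ∘ₗ conjugation V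

/-- The dual map `Φ*` in the Heisenberg picture, the unique linear map with
`Tr (Φ* Y) X = Tr Y (Φ X)` for all `X`, `Y`. -/
def dualMap [DecidableEq A] [Fintype B] (Φ : MatMap A B) : MatMap B A where
  toFun Y := Matrix.of fun a a' => (Y * Φ (Matrix.single a' a 1)).trace
  map_add' X Y := by ext; simp [Matrix.add_mul]
  map_smul' c X := by ext; simp

/-- `L` is the noncommutative graph of `Φ`, i.e. the range of the dual of a complementary
channel of `Φ`. (A complementary channel is unique up to isometric equivalence, so the range
does not depend on which one is taken.) -/
def IsNoncommutativeGraph [Fintype A] [DecidableEq A] [Fintype B]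
    (Φ : MatMap A B) (L : Submodule ℂ (Matrix A A ℂ)) : Prop :=
  ∃ (d : ℕ) (V : Matrix (B × Fin d) A ℂ),
    IsStinespring Φ V ∧ L = LinearMap.range (dualMap (complementary V))

/-- The tensor power `Φ^{⊗ n}`, on `(ℂ^A)^{⊗ n} = ℂ^(Fin n → A)`: the linear map sending the
matrix unit `E_{a₁ a₁'} ⊗ ⋯ ⊗ E_{aₙ aₙ'}` to `Φ(E_{a₁ a₁'}) ⊗ ⋯ ⊗ Φ(E_{aₙ aₙ'})`. -/
def tensorPower [Fintype A] [DecidableEq A] (n : ℕ) (Φ : MatMap A B) :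
    MatMap (Fin n → A) (Fin n → B) where
  toFun X := Matrix.of fun b b' =>
    ∑ a, ∑ a', X a a' * ∏ i, Φ (Matrix.single (a i) (a' i) 1) (b i) (b' i)
  map_add' X Y := by ext; simp [add_mul, Finset.sum_add_distrib]
  map_smul' c X := by ext; simp [mul_assoc, Finset.mul_sum]

/-- `ρ` is a state (density matrix) supported by the subspace `H`. -/
def IsStateOn [Fintype A] [DecidableEq A] (H : Submodule ℂ (EuclideanSpace ℂ A))
    (ρ : Matrix A A ℂ) : Prop :=
  ρ.PosSemidef ∧ ρ.trace = 1 ∧ LinearMap.range (Matrix.toEuclideanLin ρ) ≤ H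

/-- `H` is an error correcting code for `Φ`: some channel `Θ` satisfies `Θ (Φ ρ) = ρ` for
all states `ρ` supported by `H`. -/
def IsCode [Fintype A] [DecidableEq A] [Fintype B] (Φ : MatMap A B)
    (H : Submodule ℂ (EuclideanSpace ℂ A)) : Prop :=
  ∃ Θ : MatMap B A, IsChannel Θ ∧ ∀ ρ, IsStateOn H ρ → Θ (Φ ρ) = ρ

/-- The 1-shot quantum zero-error capacity: the supremum of `log₂ (dim H)` over the (nonzero)
error correcting codes `H`. Since `dim H ≥ 1`, the logarithm is nonnegative. -/
noncomputable def oneShotCapacity [Fintype A] [DecidableEq A] [Fintype B]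
    (Φ : MatMap A B) : ℝ≥0∞ :=
  ⨆ (H : Submodule ℂ (EuclideanSpace ℂ A)) (_ : H ≠ ⊥ ∧ IsCode Φ H),
    ENNReal.ofReal (Real.logb 2 (Module.finrank ℂ H))

/-- The asymptotic quantum zero-error capacity `sup_{n ≥ 1} n⁻¹ Q̄₀(Φ^{⊗ n})`. -/
noncomputable def zeroErrorCapacity [Fintype A] [DecidableEq A] [Fintype B]
    (Φ : MatMap A B) : ℝ≥0∞ :=
  ⨆ (n : ℕ) (_ : 1 ≤ n), oneShotCapacity (tensorPower n Φ) / n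

end Channels

/-- The subspace `𝔏_θ` of `4 × 4` matrices, with `γ = exp (iθ/2)`. -/
noncomputable def graphSpace (θ : ℝ) : Submodule ℂ (Matrix (Fin 4) (Fin 4) ℂ) where
  carrier := {M | ∃ a b c d γ : ℂ, γ = Complex.exp (Complex.I / 2 * θ) ∧
    M = !![a, b, γ * c, d;
           b, a, d, star γ * c;
           star γ * c, d, a, b;
           d, γ * c, b, a]}
  zero_mem' := ⟨0, 0, 0, 0, _, rfl, by ext i j; fin_cases i <;> fin_cases j <;> simp⟩
  add_mem' := by
    rintro _ _ ⟨a, b, c, d, γ, hγ, rfl⟩ ⟨a', b', c', d', γ', hγ', rfl⟩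
    obtain rfl : γ' = γ := hγ'.trans hγ.symm
    refine ⟨a + a', b + b', c + c', d + d', _, hγ, ?_⟩
    ext i j; fin_cases i <;> fin_cases j <;> simp [mul_add]
  smul_mem' := by
    rintro t _ ⟨a, b, c, d, γ, hγ, rfl⟩
    refine ⟨t * a, t * b, t * c, t * d, γ, hγ, ?_⟩
    ext i j; fin_cases i <;> fin_cases j <;> simp [mul_left_comm]

end ZeroError

/-!
Two facts about Kraus operators `V_e` of a channel `Φ` carry the proof. Its noncommutative graph is
the span of the products `V_e* V_e'`, so the graph of `Φ^{⊗ n}` is the `n`-th tensor power of the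
graph of `Φ`. And a subspace is a code exactly if its projection compresses every element of the
graph to a scalar (the Knill–Laflamme condition). Necessity (`dotProduct_kraus_eq_zero`) follows
because a channel `Θ` that recovers orthogonal states must be applied to states with orthogonal
supports; sufficiency (`isCode_of_knillLaflamme`) is proved by writing down recovery operators.

*No code for `n` copies.* The space `𝔏_θ` is the image of the commutative algebra `𝔏_0` under a
Schur multiplier with entries `1`, `γ` and `star γ`. The algebra `𝔏_0^{⊗ n}` is maximal commutative,
spanned by the projections onto the vectors `χ_x` of a Walsh basis. The Knill–Laflamme condition for
`𝔏_0^{⊗ n}` would force two orthonormal vectors to have disjoint supports and equal moduli in this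
basis, which is absurd. This persists under a small perturbation: if a Schur multiplier is at
distance `δ < 1 / 2` from the identity, then `p_x = |⟨χ_x, ψ⟩|` and `q_x = |⟨χ_x, φ⟩|` satisfy
`∑ p_x q_x ≤ δ` and `∑ |p_x ^ 2 - q_x ^ 2| ≤ 2 δ`, up to a common factor, while
`p ^ 2 + q ^ 2 ≤ |p ^ 2 - q ^ 2| + 2 p q` sums to `2 ≤ 4 δ` (`not_knillLaflamme_of_schurBound`). In
each tensor factor the multiplier is at distance at most `‖γ - 1‖ ≤ θ / 2` from the identity
(`phaseMat_eq`), so that `δ = (1 + ‖γ - 1‖) ^ n - 1 < exp (n θ / 2) - 1 ≤ 1 / 2` will do.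

*Codes for `m` copies.* For `θ = π / m` one has `γ ^ m + (star γ) ^ m = i - i = 0`. On the vectors
`(e_0 + i e_1) / √2` and `(e_2 + i e_3) / √2`, where `e_k` is the product vector with label `k` in
each factor, the Knill–Laflamme condition holds because the off-diagonal matrix elements of a
product of elements of `𝔏_θ` are multiples of `γ ^ m + (star γ) ^ m` (`codeVec_knillLaflamme`).
Elements of `𝔏_θ` are invariant under reversal of the order of the basis, so the reversal may be
applied in any set of factors; this gives `2 ^ m` codes, which turn out to be orthogonal.

*Existence.* The identity and three Hermitian unitaries `W` form a basis of `𝔏_θ`, so the effects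
`(1 ± W) / 6` span `𝔏_θ`; they sum to one, and the span of the effects of a measurement is the graph
of a channel (`exists_channel_of_effects`).
-/

namespace ZeroError

/-! ### Kraus operators and tensor powers of channels -/

section Kraus

variable {A B D : Type*}

/-- The map `X ↦ ∑ e, K e X (K e)*` with Kraus operators `K`. -/
def krausMap [Fintype A] [Fintype D] (K : D → Matrix B A ℂ) : MatMap A B :=
  ∑ e, conjugation (K e)

lemma krausMap_apply [Fintype A] [Fintype D] (K : D → Matrix B A ℂ) (X : Matrix A A ℂ) :
    krausMap K X = ∑ e, K e * X * (K e)ᴴ := by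
  simp [krausMap, conjugation, LinearMap.sum_apply]

lemma ampliation_krausMap [Fintype A] [Fintype D] (K : D → Matrix B A ℂ) (k : ℕ)
    (X : Matrix (Fin k × A) (Fin k × A) ℂ) :
    ampliation k (krausMap K) X = ∑ e, Matrix.kronecker (1 : Matrix (Fin k) (Fin k) ℂ) (K e) * X *
      (Matrix.kronecker (1 : Matrix (Fin k) (Fin k) ℂ) (K e))ᴴ := by
  ext ⟨p, b⟩ ⟨q, b'⟩
  simp [ampliation, krausMap_apply, Matrix.sum_apply, Matrix.mul_apply, Fintype.sum_prod_type,
    Matrix.kronecker, Matrix.one_apply, Finset.sum_mul, apply_ite]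

theorem krausMap_isChannel [Fintype A] [DecidableEq A] [Fintype B] [Fintype D]
    (K : D → Matrix B A ℂ) (hK : ∑ e, (K e)ᴴ * K e = 1) : IsChannel (krausMap K) where
  completelyPositive k X hX := by
    rw [ampliation_krausMap]
    exact Matrix.posSemidef_sum _ fun e _ => hX.mul_mul_conjTranspose_same _
  tracePreserving X := by
    rw [krausMap_apply, Matrix.trace_sum]
    calc ∑ e, (K e * X * (K e)ᴴ).trace = ∑ e, ((K e)ᴴ * K e * X).trace :=
          Finset.sum_congr rfl fun e _ => by rw [Matrix.mul_assoc, Matrix.trace_mul_comm,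
            Matrix.mul_assoc, Matrix.trace_mul_comm, Matrix.mul_assoc]
      _ = X.trace := by rw [← Matrix.trace_sum, ← Matrix.sum_mul, hK, Matrix.one_mul]

/-- The Kraus operator of a Stinespring isometry that belongs to the basis vector `e` of the
environment. -/
def krausOp (V : Matrix (B × D) A ℂ) (e : D) : Matrix B A ℂ := Matrix.of fun b a => V (b, e) a

section Stinespring

variable [Fintype A] [DecidableEq A] [Fintype B] [Fintype D]

lemma isStinespring_iff (Φ : MatMap A B) (V : Matrix (B × D) A ℂ) :
    IsStinespring Φ V ↔
      ∑ e, (krausOp V e)ᴴ * krausOp V e = 1 ∧ Φ = krausMap (krausOp V) := by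
  have h1 : ∑ e, (krausOp V e)ᴴ * krausOp V e = Vᴴ * V := by
    ext a a'
    simp only [Matrix.sum_apply, Matrix.mul_apply, Matrix.conjTranspose_apply, krausOp,
      Matrix.of_apply, Fintype.sum_prod_type]
    exact Finset.sum_comm
  have h2 : traceSnd ∘ₗ conjugation V = krausMap (krausOp V) := by
    refine LinearMap.ext fun X => ?_
    ext b b'
    simp [traceSnd, conjugation, krausMap_apply, Matrix.sum_apply, Matrix.mul_apply, krausOp]
  rw [IsStinespring, h1, h2]

lemma dualMap_complementary_apply [DecidableEq D] (V : Matrix (B × D) A ℂ) (Y : Matrix D D ℂ) :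
    dualMap (complementary V) Y =
      ∑ e, ∑ e', Y e e' • ((krausOp V e)ᴴ * krausOp V e') := by
  ext a a'
  simp only [dualMap, complementary, traceFst, conjugation, krausOp, LinearMap.coe_mk,
    AddHom.coe_mk, LinearMap.comp_apply, Matrix.trace, Matrix.diag, Matrix.mul_apply,
    Matrix.of_apply, Matrix.sum_apply, Matrix.smul_apply, Matrix.conjTranspose_apply,
    Matrix.single_apply, smul_eq_mul]
  refine Finset.sum_congr rfl fun e _ => Finset.sum_congr rfl fun e' _ => ?_
  congr 1
  refine Finset.sum_congr rfl fun b _ => ?_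
  simp [ite_and, mul_comm]

lemma trace_mul_apply_eq_trace_dualMap_mul (Φ : MatMap A B) (Y : Matrix B B ℂ)
    (X : Matrix A A ℂ) : (Y * Φ X).trace = (dualMap Φ Y * X).trace := by
  conv_lhs => rw [Matrix.matrix_eq_sum_single X]
  have h (i j : A) : Matrix.single i j (X i j) = X i j • Matrix.single i j (1 : ℂ) := by simp
  simp only [h, map_sum, map_smul, Matrix.mul_sum, Matrix.trace_sum, Matrix.mul_smul,
    Matrix.trace_smul, smul_eq_mul]
  rw [Finset.sum_comm]
  simp [Matrix.trace, Matrix.mul_apply, dualMap, mul_comm]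

end Stinespring

section TensorPower

variable {n : ℕ}

/-- The matrix of the tensor product `F 0 ⊗ ⋯ ⊗ F (n - 1)`. -/
def tensorMat (F : Fin n → Matrix B A ℂ) : Matrix (Fin n → B) (Fin n → A) ℂ :=
  Matrix.of fun b a => ∏ i, F i (b i) (a i)

lemma tensorMat_mul {C : Type*} [Fintype B] (F : Fin n → Matrix C B ℂ)
    (G : Fin n → Matrix B A ℂ) :
    tensorMat F * tensorMat G = tensorMat fun i => F i * G i := by
  ext c a
  simp only [tensorMat, Matrix.mul_apply, Matrix.of_apply, ← Finset.prod_mul_distrib,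
    Fintype.prod_sum]

lemma conjTranspose_tensorMat (F : Fin n → Matrix B A ℂ) :
    (tensorMat F)ᴴ = tensorMat fun i => (F i)ᴴ := by
  ext a b
  simp [tensorMat]

lemma tensorMat_sum [Fintype D] (F : Fin n → D → Matrix B A ℂ) :
    tensorMat (fun i => ∑ e, F i e) = ∑ e : Fin n → D, tensorMat fun i => F i (e i) := by
  ext b a
  simp only [tensorMat, Matrix.of_apply, Matrix.sum_apply, Fintype.prod_sum]

lemma tensorMat_smul (c : Fin n → ℂ) (F : Fin n → Matrix B A ℂ) :
    tensorMat (fun i => c i • F i) = (∏ i, c i) • tensorMat F := by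
  ext b a
  simp [tensorMat, Finset.prod_mul_distrib]

lemma tensorMat_one [DecidableEq A] : tensorMat (fun _ : Fin n => (1 : Matrix A A ℂ)) = 1 := by
  ext a a'
  simp [tensorMat, Matrix.one_apply, Finset.prod_ite_zero, funext_iff]

lemma sum_conjTranspose_mul_tensorMat [Fintype B] [Fintype D] [DecidableEq A]
    (K : D → Matrix B A ℂ) (hK : ∑ e, (K e)ᴴ * K e = 1) :
    ∑ e : Fin n → D, (tensorMat fun i => K (e i))ᴴ * (tensorMat fun i => K (e i)) = 1 := by
  simp only [conjTranspose_tensorMat, tensorMat_mul]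
  rw [← tensorMat_sum (fun _ e => (K e)ᴴ * K e), hK, tensorMat_one]

lemma tensorPower_krausMap [Fintype A] [DecidableEq A] [Fintype D] (K : D → Matrix B A ℂ) :
    tensorPower n (krausMap K) = krausMap fun e : Fin n → D => tensorMat fun i => K (e i) := by
  refine LinearMap.ext fun X => ?_
  ext b b'
  have h (a a' : A) (b b' : B) :
      krausMap K (Matrix.single a a' 1) b b' = ∑ e, K e b a * star (K e b' a') := by
    simp [krausMap_apply, Matrix.sum_apply, Matrix.mul_apply, Matrix.single_apply, ite_and]
  simp only [tensorPower, LinearMap.coe_mk, AddHom.coe_mk, Matrix.of_apply, h, Fintype.prod_sum]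
  simp only [krausMap_apply, Matrix.sum_apply, Matrix.mul_apply, tensorMat,
    Matrix.conjTranspose_apply, Matrix.of_apply, Finset.sum_mul, Finset.mul_sum,
    Finset.prod_mul_distrib, star_prod]
  rw [Finset.sum_comm]
  rw [Finset.sum_comm (s := Finset.univ (α := Fin n → D))]
  refine Finset.sum_congr rfl fun a' _ => ?_
  rw [Finset.sum_comm]
  refine Finset.sum_congr rfl fun e _ => Finset.sum_congr rfl fun a _ => ?_
  ring

end TensorPower

end Kraus

/-! ### Necessity of the Knill–Laflamme condition -/

section Necessity

variable {A B D : Type*}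

lemma trace_mul_vecMulVec [Fintype A] (Q : Matrix A A ℂ) (x y : A → ℂ) :
    (Q * Matrix.vecMulVec x (star y)).trace = star y ⬝ᵥ (Q *ᵥ x) := by
  rw [Matrix.mul_vecMulVec, Matrix.trace_vecMulVec, dotProduct_comm]

lemma posSemidef_of_forall_nonneg [Fintype A] [DecidableEq A] {Q : Matrix A A ℂ}
    (h : ∀ x, 0 ≤ star x ⬝ᵥ (Q *ᵥ x)) : Q.PosSemidef := by
  rw [← Matrix.isPositive_toEuclideanLin_iff, LinearMap.isPositive_iff_complex]
  intro x
  have hx : inner ℂ (Q.toEuclideanLin x) x = star (star x.ofLp ⬝ᵥ (Q *ᵥ x.ofLp)) := by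
    rw [EuclideanSpace.inner_eq_star_dotProduct, dotProduct_comm, Matrix.star_dotProduct]
    simp [Matrix.ofLp_toLpLin]
  have h0 := Complex.nonneg_iff.1 (h x.ofLp)
  rw [hx]
  refine ⟨?_, by simpa using h0.1⟩
  apply Complex.ext <;> simp [← h0.2]

lemma IsChannel.posSemidef_apply [Fintype A] [Fintype B] {Φ : MatMap A B} (hΦ : IsChannel Φ)
    {X : Matrix A A ℂ} (hX : X.PosSemidef) : (Φ X).PosSemidef :=
  (hΦ.completelyPositive 1 _ (hX.submatrix (Prod.snd : Fin 1 × A → A))).submatrix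
    fun b => ((0 : Fin 1), b)

lemma IsChannel.dualMap_posSemidef [Fintype A] [DecidableEq A] [Fintype B] {Φ : MatMap A B}
    (hΦ : IsChannel Φ) (C : Matrix B B ℂ) : (dualMap Φ (Cᴴ * C)).PosSemidef := by
  refine posSemidef_of_forall_nonneg fun x => ?_
  rw [← trace_mul_vecMulVec, ← trace_mul_apply_eq_trace_dualMap_mul, Matrix.mul_assoc,
    Matrix.trace_mul_comm]
  exact ((hΦ.posSemidef_apply
    (Matrix.posSemidef_vecMulVec_self_star x)).mul_mul_conjTranspose_same C).trace_nonneg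

lemma IsChannel.dualMap_one [Fintype A] [DecidableEq A] [Fintype B] [DecidableEq B]
    {Φ : MatMap A B} (hΦ : IsChannel Φ) : dualMap Φ 1 = 1 := by
  ext a a'
  simp only [dualMap, LinearMap.coe_mk, AddHom.coe_mk, Matrix.of_apply, Matrix.one_mul,
    hΦ.tracePreserving]
  rcases eq_or_ne a a' with rfl | h
  · simp
  · simp [h, Matrix.trace_single_eq_of_ne _ _ _ h.symm]

lemma krausMap_vecMulVec [Fintype A] [Fintype D] (K : D → Matrix B A ℂ) (x y : A → ℂ) :
    krausMap K (Matrix.vecMulVec x (star y)) =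
      ∑ e, Matrix.vecMulVec (K e *ᵥ x) (star (K e *ᵥ y)) := by
  rw [krausMap_apply]
  refine Finset.sum_congr rfl fun e _ => ?_
  rw [Matrix.mul_vecMulVec, Matrix.vecMulVec_mul, Matrix.star_mulVec]

lemma mulVec_kraus_eq_zero_of_trace_eq_zero [Fintype A] [Fintype B] [Fintype D]
    (K : D → Matrix B A ℂ) {Q : Matrix B B ℂ} (hQ : Q.PosSemidef) (x : A → ℂ)
    (h : (Q * krausMap K (Matrix.vecMulVec x (star x))).trace = 0) (e : D) :
    Q *ᵥ (K e *ᵥ x) = 0 := by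
  simp only [krausMap_vecMulVec, Matrix.mul_sum, Matrix.trace_sum, trace_mul_vecMulVec] at h
  rw [Finset.sum_eq_zero_iff_of_nonneg fun e _ => hQ.dotProduct_mulVec_nonneg _] at h
  exact (hQ.dotProduct_mulVec_zero_iff _).1 (h e (Finset.mem_univ e))

/-- If a channel `Θ` recovers two orthogonal pure states from the outputs of a Kraus map, then
all Kraus operators map these states to orthogonal vectors. The reason is that the effect
`Θ* (ψ ψ*)` acts as the identity on the output of `ψ` and annihilates the output of `φ`. -/
theorem dotProduct_kraus_eq_zero [Fintype A] [DecidableEq A] [Fintype B] [DecidableEq B]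
    [Fintype D] (K : D → Matrix B A ℂ) {Θ : MatMap B A} (hΘ : IsChannel Θ) {ψ φ : A → ℂ}
    (hψ : star ψ ⬝ᵥ ψ = 1) (hψφ : star ψ ⬝ᵥ φ = 0)
    (h1 : Θ (krausMap K (Matrix.vecMulVec ψ (star ψ))) = Matrix.vecMulVec ψ (star ψ))
    (h2 : Θ (krausMap K (Matrix.vecMulVec φ (star φ))) = Matrix.vecMulVec φ (star φ))
    (e e' : D) : star (K e *ᵥ ψ) ⬝ᵥ (K e' *ᵥ φ) = 0 := by
  set P := Matrix.vecMulVec ψ (star ψ) with hP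
  have hPh : Pᴴ = P := by simp [hP, Matrix.conjTranspose_vecMulVec]
  have hPP : P * P = P := by
    rw [hP, Matrix.vecMulVec_mul_vecMulVec, hψ, one_smul]
  have hPφ : P *ᵥ φ = 0 := by rw [hP, Matrix.vecMulVec_mulVec, hψφ]; simp
  have hQ : (dualMap Θ P).PosSemidef := by
    have := hΘ.dualMap_posSemidef P
    rwa [hPh, hPP] at this
  have hQ' : (dualMap Θ (1 - P)).PosSemidef := by
    have := hΘ.dualMap_posSemidef (1 - P)
    have h : (1 - P)ᴴ * (1 - P) = 1 - P := by
      rw [Matrix.conjTranspose_sub, Matrix.conjTranspose_one, hPh]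
      simp [sub_mul, mul_sub, hPP]
    rwa [h] at this
  have hv : dualMap Θ P *ᵥ (K e *ᵥ ψ) = K e *ᵥ ψ := by
    have h := mulVec_kraus_eq_zero_of_trace_eq_zero K hQ' ψ
      (by rw [← trace_mul_apply_eq_trace_dualMap_mul, h1]; simp [sub_mul, hPP]) e
    rw [map_sub, hΘ.dualMap_one, Matrix.sub_mulVec, Matrix.one_mulVec, sub_eq_zero] at h
    exact h.symm
  have hw : dualMap Θ P *ᵥ (K e' *ᵥ φ) = 0 :=
    mulVec_kraus_eq_zero_of_trace_eq_zero K hQ φ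
      (by rw [← trace_mul_apply_eq_trace_dualMap_mul, h2, trace_mul_vecMulVec, hPφ]; simp) e'
  rw [← hv, Matrix.star_mulVec, hQ.isHermitian.eq, ← Matrix.dotProduct_mulVec, hw,
    dotProduct_zero]

lemma isStateOn_vecMulVec [Fintype A] [DecidableEq A] {H : Submodule ℂ (EuclideanSpace ℂ A)}
    {x : EuclideanSpace ℂ A} (hx : x ∈ H) (hn : star x.ofLp ⬝ᵥ x.ofLp = 1) :
    IsStateOn H (Matrix.vecMulVec x.ofLp (star x.ofLp)) := by
  refine ⟨Matrix.posSemidef_vecMulVec_self_star _, ?_, ?_⟩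
  · rw [Matrix.trace_vecMulVec, dotProduct_comm, hn]
  · rintro _ ⟨y, rfl⟩
    have : Matrix.toEuclideanLin (Matrix.vecMulVec x.ofLp (star x.ofLp)) y =
        (star x.ofLp ⬝ᵥ y.ofLp) • x := by
      ext i
      simp [Matrix.ofLp_toLpLin, Matrix.vecMulVec_mulVec, mul_comm]
    rw [this]
    exact H.smul_mem _ hx

/-- The Knill–Laflamme condition for products of two Kraus operators, on a pair of orthogonal
unit vectors of a code. -/
theorem IsCode.exists_orthonormal_pair [Fintype A] [DecidableEq A] [Fintype B]
    [Fintype D] (K : D → Matrix B A ℂ) {H : Submodule ℂ (EuclideanSpace ℂ A)}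
    (hH : IsCode (krausMap K) H) (hdim : 2 ≤ Module.finrank ℂ H) :
    ∃ ψ φ : A → ℂ, star ψ ⬝ᵥ ψ = 1 ∧ star φ ⬝ᵥ φ = 1 ∧ ∀ e e',
      star ψ ⬝ᵥ (((K e)ᴴ * K e') *ᵥ φ) = 0 ∧
      star ψ ⬝ᵥ (((K e)ᴴ * K e') *ᵥ ψ) = star φ ⬝ᵥ (((K e)ᴴ * K e') *ᵥ φ) := by
  classical
  obtain ⟨Θ, hΘ, hrec⟩ := hH
  let b := stdOrthonormalBasis ℂ H
  let i : Fin (Module.finrank ℂ H) := ⟨0, by omega⟩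
  let j : Fin (Module.finrank ℂ H) := ⟨1, by omega⟩
  have hij : i ≠ j := by simp [i, j]
  have key {x y : EuclideanSpace ℂ A} (hx : x ∈ H) (hy : y ∈ H)
      (hxx : inner ℂ x x = 1) (hyy : inner ℂ y y = 1) (hxy : inner ℂ x y = 0) (e e' : D) :
      star x.ofLp ⬝ᵥ (((K e)ᴴ * K e') *ᵥ y.ofLp) = 0 := by
    rw [EuclideanSpace.inner_eq_star_dotProduct, dotProduct_comm] at hxx hyy hxy
    have := dotProduct_kraus_eq_zero K hΘ hxx hxy (hrec _ (isStateOn_vecMulVec hx hxx))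
      (hrec _ (isStateOn_vecMulVec hy hyy)) e e'
    rwa [Matrix.star_mulVec, ← Matrix.dotProduct_mulVec, Matrix.mulVec_mulVec] at this
  let v (k) : EuclideanSpace ℂ A := b k
  have hv (k) : v k ∈ H := (b k).2
  have hu (k) : inner ℂ (v k) (v k) = 1 :=
    (orthonormal_iff_ite.1 b.orthonormal k k).trans (if_pos rfl)
  have ho {k l} (h : k ≠ l) : inner ℂ (v k) (v l) = 0 :=
    (orthonormal_iff_ite.1 b.orthonormal k l).trans (if_neg h)
  have hu' (k) : star (v k).ofLp ⬝ᵥ (v k).ofLp = 1 := by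
    rw [← hu k, EuclideanSpace.inner_eq_star_dotProduct, dotProduct_comm]
  refine ⟨(v i).ofLp, (v j).ofLp, hu' i, hu' j,
    fun e e' => ⟨key (hv i) (hv j) (hu i) (hu j) (ho hij) e e', ?_⟩⟩
  -- the vectors `(ψ ± φ) / √2` are orthonormal as well
  let s : ℂ := (Real.sqrt 2 : ℂ)⁻¹
  have hs : s * s = 1 / 2 := by
    simp only [s, ← mul_inv, ← Complex.ofReal_mul]
    norm_num
  have hsc : (starRingEnd ℂ) s = s := by simp [s]
  have h := key (x := s • (v i + v j)) (y := s • (v i - v j))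
    (H.smul_mem _ (H.add_mem (hv i) (hv j))) (H.smul_mem _ (H.sub_mem (hv i) (hv j)))
    (by simp only [inner_smul_left, inner_smul_right, inner_add_left, inner_add_right, hu,
          ho hij, ho hij.symm, hsc]
        linear_combination 2 * hs)
    (by simp only [inner_smul_left, inner_smul_right, inner_sub_left, inner_sub_right, hu,
          ho hij, ho hij.symm, hsc]
        linear_combination 2 * hs)
    (by simp only [inner_smul_left, inner_smul_right, inner_add_left, inner_sub_right, hu,
          ho hij, ho hij.symm, hsc]
        ring) e e'
  have h1 := key (hv i) (hv j) (hu i) (hu j) (ho hij) e e'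
  have h2 := key (hv j) (hv i) (hu j) (hu i) (ho hij.symm) e e'
  have hstar : star s = s := hsc
  simp only [WithLp.ofLp_smul, WithLp.ofLp_add, WithLp.ofLp_sub, star_smul, star_add,
    smul_dotProduct, Matrix.mulVec_smul, dotProduct_smul, add_dotProduct, Matrix.mulVec_sub,
    dotProduct_sub, h1, h2, smul_eq_mul, hstar] at h
  linear_combination 2 * h - 2 * (star (v i).ofLp ⬝ᵥ ((K e)ᴴ * K e') *ᵥ (v i).ofLp -
    star (v j).ofLp ⬝ᵥ ((K e)ᴴ * K e') *ᵥ (v j).ofLp) * hs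

end Necessity

/-! ### Sufficiency of the Knill–Laflamme condition -/

section Sufficiency

variable {A B D ι : Type*}

/-- Families of vectors that are mutually orthogonal and share one Gram matrix have orthonormal
bases of their spans in which they have the same coordinates. -/
lemma exists_orthonormal_coordinates {F : Type*} [NormedAddCommGroup F] [InnerProductSpace ℂ F]
    [Fintype D] [DecidableEq ι] (i₀ : ι) (v : ι → D → F) (G : D → D → ℂ)
    (hv : ∀ i j e e', inner ℂ (v i e) (v j e') = if i = j then G e e' else 0) :
    ∃ (r : ℕ) (f : ι → Fin r → F) (c : Fin r → D → ℂ),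
      (∀ i j k l, inner ℂ (f i k) (f j l) = if i = j ∧ k = l then 1 else 0) ∧
      ∀ i e, v i e = ∑ k, c k e • f i k := by
  let S := Submodule.span ℂ (Set.range (v i₀))
  have : FiniteDimensional ℂ S := FiniteDimensional.span_of_finite ℂ (Set.finite_range _)
  let b := stdOrthonormalBasis ℂ S
  have hb (k) : ∃ α : D → ℂ, ∑ e, α e • v i₀ e = b k :=
    (Submodule.mem_span_range_iff_exists_fun ℂ).1 (b k).2
  choose α hα using hb
  have hcomb (i j : ι) (x y : D → ℂ) : inner ℂ (∑ e, x e • v i e) (∑ e, y e • v j e) =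
      if i = j then inner ℂ (∑ e, x e • v i₀ e) (∑ e, y e • v i₀ e) else 0 := by
    simp only [sum_inner, inner_sum, inner_smul_left, inner_smul_right, hv]
    split_ifs <;> simp
  refine ⟨_, fun i k => ∑ e, α k e • v i e, fun k e => inner ℂ (b k : F) (v i₀ e), ?_, ?_⟩
  · intro i j k l
    rw [hcomb, hα, hα, ite_and]
    congr 1
    exact orthonormal_iff_ite.1 b.orthonormal k l
  · intro i e
    classical
    -- a linear relation among the vectors `v i₀ e` holds among the `v i e` as well
    have h0 : v i₀ e = ∑ k, inner ℂ (b k : F) (v i₀ e) • ∑ e', α k e' • v i₀ e' := by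
      have h := congrArg (Subtype.val) (b.sum_repr' ⟨v i₀ e, Submodule.subset_span ⟨e, rfl⟩⟩)
      simp only [Submodule.coe_sum, Submodule.coe_smul, Submodule.coe_inner] at h
      simp only [hα]
      exact h.symm
    let x : D → ℂ := fun e' => (if e' = e then 1 else 0) - ∑ k, inner ℂ (b k : F) (v i₀ e) * α k e'
    have hx (j : ι) : ∑ e', x e' • v j e' =
        v j e - ∑ k, inner ℂ (b k : F) (v i₀ e) • ∑ e', α k e' • v j e' := by
      simp only [x, sub_smul, Finset.sum_sub_distrib, ite_smul, one_smul, zero_smul,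
        Finset.sum_ite_eq', Finset.mem_univ, if_true, Finset.sum_smul, Finset.smul_sum, mul_smul]
      rw [Finset.sum_comm]
    have h := hcomb i i x x
    rw [if_pos rfl, hx i₀, ← h0, sub_self, inner_zero_left, inner_self_eq_zero, hx i,
      sub_eq_zero] at h
    exact h

/-- The orthogonal projection onto the span of an orthonormal family. -/
def projMat [Fintype ι] (f : ι → B → ℂ) : Matrix B B ℂ :=
  ∑ i, Matrix.vecMulVec (f i) (star (f i))

lemma conjTranspose_projMat [Fintype ι] (f : ι → B → ℂ) : (projMat f)ᴴ = projMat f := by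
  simp [projMat, Matrix.conjTranspose_sum, Matrix.conjTranspose_vecMulVec]

lemma projMat_mulVec [Fintype ι] [Fintype B] (f : ι → B → ℂ) (x : B → ℂ) :
    projMat f *ᵥ x = ∑ i, (star (f i) ⬝ᵥ x) • f i := by
  simp [projMat, Matrix.sum_mulVec, Matrix.vecMulVec_mulVec]

lemma projMat_mulVec_self [Fintype ι] [DecidableEq ι] [Fintype B] {f : ι → B → ℂ}
    (hf : ∀ i j, star (f i) ⬝ᵥ f j = if i = j then 1 else 0) (i : ι) :
    projMat f *ᵥ f i = f i := by
  simp [projMat_mulVec, hf]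

lemma projMat_mul_self [Fintype ι] [DecidableEq ι] [Fintype B] {f : ι → B → ℂ}
    (hf : ∀ i j, star (f i) ⬝ᵥ f j = if i = j then 1 else 0) :
    projMat f * projMat f = projMat f := by
  conv_lhs => rhs; rw [projMat]
  simp only [Matrix.mul_sum, Matrix.mul_vecMulVec, projMat_mulVec_self hf]
  rfl

/-- Recovery operators: for each `k`, the operator that sends `f i k` to `ψ i`; for each basis
vector of the output space, an operator that sends the orthogonal complement of all `f i k` to
`ψ i₀`, so that the sum preserves the trace. -/
def recoveryOp [Fintype ι] [DecidableEq B] {r : ℕ} (i₀ : ι) (ψ : ι → A → ℂ)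
    (f : ι → Fin r → B → ℂ) : Fin r ⊕ B → Matrix A B ℂ
  | .inl k => ∑ i, Matrix.vecMulVec (ψ i) (star (f i k))
  | .inr b => Matrix.vecMulVec (ψ i₀) ((1 - projMat fun p : ι × Fin r => f p.1 p.2) b)

section Recovery

variable [Fintype B] [DecidableEq B] [Fintype ι] [DecidableEq ι] {r : ℕ} {i₀ : ι}
  {ψ : ι → A → ℂ} {f : ι → Fin r → B → ℂ}

lemma sum_conjTranspose_mul_recoveryOp [Fintype A]
    (hψ : ∀ i j, star (ψ i) ⬝ᵥ ψ j = if i = j then 1 else 0)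
    (hf : ∀ i j k l, star (f i k) ⬝ᵥ f j l = if i = j ∧ k = l then 1 else 0) :
    ∑ s, (recoveryOp i₀ ψ f s)ᴴ * recoveryOp i₀ ψ f s = 1 := by
  set P := projMat fun p : ι × Fin r => f p.1 p.2 with hP
  have hPP : P * P = P := projMat_mul_self fun p q => by simp [hf, Prod.ext_iff]
  have hPh : Pᴴ = P := conjTranspose_projMat _
  have h1 : ∑ k, (recoveryOp i₀ ψ f (.inl k))ᴴ * recoveryOp i₀ ψ f (.inl k) = P := by
    simp only [recoveryOp, Matrix.conjTranspose_sum, Matrix.conjTranspose_vecMulVec, star_star,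
      Matrix.sum_mul, Matrix.mul_sum, Matrix.vecMulVec_mul_vecMulVec, hψ, ite_smul, one_smul,
      zero_smul, hP, projMat, Fintype.sum_prod_type]
    rw [Finset.sum_comm]
    refine Finset.sum_congr rfl fun i _ => Finset.sum_congr rfl fun k _ => ?_
    rw [Finset.sum_eq_single i] <;> simp +contextual [Matrix.vecMulVec_zero]
  have h2 : ∑ b, (recoveryOp i₀ ψ f (.inr b))ᴴ * recoveryOp i₀ ψ f (.inr b) =
      (1 - P)ᴴ * (1 - P) := by
    simp only [recoveryOp, Matrix.conjTranspose_vecMulVec, Matrix.vecMulVec_mul_vecMulVec, hψ,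
      if_true, one_smul, ← hP]
    generalize 1 - P = W
    ext b b'
    simp [Matrix.sum_apply, Matrix.vecMulVec_apply, Matrix.mul_apply]
  rw [Fintype.sum_sum_type, h1, h2, Matrix.conjTranspose_sub, Matrix.conjTranspose_one, hPh]
  simp [sub_mul, mul_sub, hPP]

lemma recoveryOp_inl_mulVec
    (hf : ∀ i j k l, star (f i k) ⬝ᵥ f j l = if i = j ∧ k = l then 1 else 0)
    (c : Fin r → ℂ) (j : ι) (k : Fin r) :
    recoveryOp i₀ ψ f (.inl k) *ᵥ ∑ l, c l • f j l = c k • ψ j := by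
  simp only [recoveryOp, Matrix.sum_mulVec, Matrix.vecMulVec_mulVec, dotProduct_sum,
    dotProduct_smul, hf]
  rw [Finset.sum_eq_single j]
  · simp
  · intro i _ hij
    simp [hij]
  · simp

lemma recoveryOp_inr_mulVec
    (hf : ∀ i j k l, star (f i k) ⬝ᵥ f j l = if i = j ∧ k = l then 1 else 0)
    (c : Fin r → ℂ) (j : ι) (b : B) :
    recoveryOp i₀ ψ f (.inr b) *ᵥ ∑ l, c l • f j l = 0 := by
  have h : (1 - projMat fun p : ι × Fin r => f p.1 p.2) *ᵥ ∑ l, c l • f j l = 0 := by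
    rw [Matrix.mulVec_sum]
    refine Finset.sum_eq_zero fun l _ => ?_
    have := projMat_mulVec_self (f := fun p : ι × Fin r => f p.1 p.2)
      (fun p q => by simp [hf, Prod.ext_iff]) (j, l)
    simp only at this
    rw [Matrix.mulVec_smul, Matrix.sub_mulVec, this, Matrix.one_mulVec, sub_self, smul_zero]
  have hb := congrFun h b
  rw [Matrix.mulVec, Pi.zero_apply] at hb
  rw [recoveryOp, Matrix.vecMulVec_mulVec, hb]
  simp

end Recovery

/-- A state supported by the span of an orthonormal family is a linear combination of
the operators `ψ i (ψ j)*`. -/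
lemma IsStateOn.eq_sum [Fintype A] [DecidableEq A] [Fintype ι] [DecidableEq ι]
    {ψ : ι → A → ℂ} (hψ : ∀ i j, star (ψ i) ⬝ᵥ ψ j = if i = j then 1 else 0) {ρ : Matrix A A ℂ}
    (hρ : IsStateOn (Submodule.span ℂ (Set.range fun i => WithLp.toLp 2 (ψ i))) ρ) :
    ρ = ∑ i, ∑ j, (star (ψ i) ⬝ᵥ (ρ *ᵥ ψ j)) • Matrix.vecMulVec (ψ i) (star (ψ j)) := by
  have h1 : projMat ψ * ρ = ρ := by
    refine Matrix.toLin'.injective (LinearMap.ext fun y => ?_)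
    have hy : Matrix.toEuclideanLin ρ (WithLp.toLp 2 y) ∈ _ := hρ.2.2 ⟨WithLp.toLp 2 y, rfl⟩
    obtain ⟨c, hc⟩ := (Submodule.mem_span_range_iff_exists_fun ℂ).1 hy
    have hc' : ρ *ᵥ y = ∑ i, c i • ψ i := by
      have := congrArg WithLp.ofLp hc
      simpa [Matrix.ofLp_toLpLin] using this.symm
    rw [Matrix.toLin'_apply, Matrix.toLin'_apply, ← Matrix.mulVec_mulVec, hc',
      Matrix.mulVec_sum]
    simp only [Matrix.mulVec_smul, projMat_mulVec_self hψ]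
  have h2 : ρ * projMat ψ = ρ := by
    have := congrArg Matrix.conjTranspose h1
    rwa [Matrix.conjTranspose_mul, conjTranspose_projMat, hρ.1.isHermitian.eq] at this
  conv_lhs => rw [← h1, ← h2, ← Matrix.mul_assoc, projMat]
  simp only [Matrix.sum_mul, Matrix.mul_sum]
  rw [Finset.sum_comm]
  refine Finset.sum_congr rfl fun i _ => Finset.sum_congr rfl fun j _ => ?_
  rw [Matrix.mul_assoc, Matrix.mul_vecMulVec, Matrix.vecMulVec_mul_vecMulVec,
    Matrix.vecMulVec_smul]

/-- The Knill–Laflamme condition is sufficient: an orthonormal family on which all products of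
two Kraus operators act as scalars spans an error correcting code. -/
theorem isCode_of_knillLaflamme [Fintype A] [DecidableEq A] [Fintype B] [Fintype D]
    [Fintype ι] [DecidableEq ι] [Nonempty ι]
    (K : D → Matrix B A ℂ) (hK : ∑ e, (K e)ᴴ * K e = 1) (ψ : ι → A → ℂ)
    (hψ : ∀ i j, star (ψ i) ⬝ᵥ ψ j = if i = j then 1 else 0) (G : D → D → ℂ)
    (hKL : ∀ i j e e', star (ψ i) ⬝ᵥ (((K e)ᴴ * K e') *ᵥ ψ j) = if i = j then G e e' else 0) :
    IsCode (krausMap K) (Submodule.span ℂ (Set.range fun i => WithLp.toLp 2 (ψ i))) := by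
  classical
  let i₀ : ι := Classical.arbitrary ι
  obtain ⟨r, f', c, hf', hv'⟩ := exists_orthonormal_coordinates i₀
    (fun i e => (WithLp.toLp 2 (K e *ᵥ ψ i) : EuclideanSpace ℂ B)) G (by
      intro i j e e'
      rw [← hKL, EuclideanSpace.inner_eq_star_dotProduct, dotProduct_comm, Matrix.star_mulVec,
        ← Matrix.dotProduct_mulVec, Matrix.mulVec_mulVec])
  let f : ι → Fin r → B → ℂ := fun i k => (f' i k).ofLp
  have hf (i j k l) : star (f i k) ⬝ᵥ f j l = if i = j ∧ k = l then 1 else 0 := by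
    rw [← hf', EuclideanSpace.inner_eq_star_dotProduct, dotProduct_comm]
  have hv (i e) : K e *ᵥ ψ i = ∑ k, c k e • f i k := by
    simpa [f] using congrArg WithLp.ofLp (hv' i e)
  have hR := sum_conjTranspose_mul_recoveryOp (i₀ := i₀) hψ hf
  have hΘ := krausMap_isChannel _ hR
  refine ⟨krausMap (recoveryOp i₀ ψ f), hΘ, ?_⟩
  set Θ := krausMap (recoveryOp i₀ ψ f) with hΘdef
  let t : ℂ := ∑ e, ∑ k, star (c k e) * c k e
  have hrec (i j) : Θ (krausMap K (Matrix.vecMulVec (ψ i) (star (ψ j)))) =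
      t • Matrix.vecMulVec (ψ i) (star (ψ j)) := by
    simp only [krausMap_vecMulVec, map_sum, hΘdef, Fintype.sum_sum_type, hv,
      recoveryOp_inl_mulVec hf, recoveryOp_inr_mulVec hf, t, Finset.sum_smul]
    refine Finset.sum_congr rfl fun e _ => ?_
    simp [Matrix.smul_vecMulVec, Matrix.vecMulVec_smul, smul_smul]
  have ht : t = 1 := by
    have h := congrArg Matrix.trace (hrec i₀ i₀)
    rw [hΘ.tracePreserving, (krausMap_isChannel K hK).tracePreserving, Matrix.trace_smul,
      Matrix.trace_vecMulVec, dotProduct_comm, hψ] at h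
    simpa using h.symm
  intro ρ hρ
  rw [hρ.eq_sum hψ]
  simp only [map_sum, map_smul, hrec, ht, one_smul]

end Sufficiency

/-! ### Schur multipliers close to the trivial one -/

section SchurBound

variable {ι X Y : Type*} [Fintype ι]

/-- The value `⟨ψ, (K ∘ χ_x χ_x*) φ⟩`, where `∘` is the entrywise product with the kernel `K`. -/
def schurForm (χ : X → ι → ℂ) (K : ι → ι → ℂ) (ψ φ : ι → ℂ) (x : X) : ℂ :=
  ∑ a, ∑ a', star (ψ a) * (χ x a * K a a' * star (χ x a')) * φ a'

/-- The Schur multiplier with kernel `K` has norm at most `c` on operators that are diagonal in the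
basis `χ` (orthogonal vectors of square norm `N`), stated dually as an `ℓ¹` bound on its values at
`χ_x χ_x*`. The mean of the squared norms stands in place of the product `‖ψ‖ ‖φ‖`, which avoids
square roots and agrees with it on unit vectors. -/
def SchurBound [Fintype X] (χ : X → ι → ℂ) (N : ℝ) (K : ι → ι → ℂ) (c : ℝ) : Prop :=
  ∀ ψ φ : ι → ℂ, ∑ x, ‖schurForm χ K ψ φ x‖ ≤
    c * (N * ((∑ a, ‖ψ a‖ ^ 2 + ∑ a, ‖φ a‖ ^ 2) / 2))

variable {χ : X → ι → ℂ} {N : ℝ}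

lemma schurForm_add (K L : ι → ι → ℂ) (ψ φ : ι → ℂ) (x : X) :
    schurForm χ (fun a a' => K a a' + L a a') ψ φ x =
      schurForm χ K ψ φ x + schurForm χ L ψ φ x := by
  simp only [schurForm, ← Finset.sum_add_distrib]
  exact Finset.sum_congr rfl fun a _ => Finset.sum_congr rfl fun a' _ => by ring

lemma schurForm_one (ψ φ : ι → ℂ) (x : X) :
    schurForm χ (fun _ _ => 1) ψ φ x =
      star (∑ a, star (χ x a) * ψ a) * ∑ a, star (χ x a) * φ a := by
  simp only [schurForm, star_sum, star_mul', star_star, Finset.sum_mul, Finset.mul_sum]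
  rw [Finset.sum_comm]
  exact (Finset.sum_congr rfl fun a _ => Finset.sum_congr rfl fun a' _ => by ring)

lemma schurForm_diag_mul (K : ι → ι → ℂ) (u v : ι → ℂ) (ψ φ : ι → ℂ) (x : X) :
    schurForm χ (fun a a' => u a * v a' * K a a') ψ φ x =
      schurForm χ K (fun a => star (u a) * ψ a) (fun a => v a * φ a) x := by
  simp only [schurForm, star_mul', star_star]
  exact (Finset.sum_congr rfl fun a _ => Finset.sum_congr rfl fun a' _ => by ring)

lemma schurForm_sum [Fintype Y] (c : ℂ) (K : Y → ι → ι → ℂ) (ψ φ : ι → ℂ) (x : X) :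
    schurForm χ (fun a a' => c * ∑ y, K y a a') ψ φ x = c * ∑ y, schurForm χ (K y) ψ φ x := by
  simp only [schurForm, Finset.mul_sum, Finset.sum_mul]
  rw [Finset.sum_comm (s := Finset.univ (α := Y))]
  refine Finset.sum_congr rfl fun a _ => ?_
  rw [Finset.sum_comm]
  exact (Finset.sum_congr rfl fun a _ => Finset.sum_congr rfl fun a' _ => by ring)

variable [Fintype X]

lemma SchurBound.one
    (hχ : ∀ φ : ι → ℂ, ∑ x, ‖∑ a, star (χ x a) * φ a‖ ^ 2 = N * ∑ a, ‖φ a‖ ^ 2) :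
    SchurBound χ N (fun _ _ => 1) 1 := by
  intro ψ φ
  have h (x : X) : ‖schurForm χ (fun _ _ => 1) ψ φ x‖ ≤
      (‖∑ a, star (χ x a) * ψ a‖ ^ 2 + ‖∑ a, star (χ x a) * φ a‖ ^ 2) / 2 := by
    rw [schurForm_one, norm_mul, norm_star]
    linarith [two_mul_le_add_sq ‖∑ a, star (χ x a) * ψ a‖ ‖∑ a, star (χ x a) * φ a‖]
  calc _ ≤ ∑ x, (‖∑ a, star (χ x a) * ψ a‖ ^ 2 + ‖∑ a, star (χ x a) * φ a‖ ^ 2) / 2 :=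
        Finset.sum_le_sum fun x _ => h x
    _ = _ := by rw [← Finset.sum_div, Finset.sum_add_distrib, hχ, hχ]; ring

lemma SchurBound.add {K L : ι → ι → ℂ} {c d : ℝ} (hK : SchurBound χ N K c)
    (hL : SchurBound χ N L d) : SchurBound χ N (fun a a' => K a a' + L a a') (c + d) := by
  intro ψ φ
  rw [add_mul]
  refine le_trans ?_ (add_le_add (hK ψ φ) (hL ψ φ))
  rw [← Finset.sum_add_distrib]
  exact Finset.sum_le_sum fun x _ => by rw [schurForm_add]; exact norm_add_le _ _

lemma SchurBound.diag_mul {K : ι → ι → ℂ} {c : ℝ} (hK : SchurBound χ N K c) (hc : 0 ≤ c)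
    (hN : 0 ≤ N) {u v : ι → ℂ} (hu : ∀ a, ‖u a‖ ≤ 1) (hv : ∀ a, ‖v a‖ ≤ 1) :
    SchurBound χ N (fun a a' => u a * v a' * K a a') c := by
  intro ψ φ
  simp only [schurForm_diag_mul]
  refine (hK _ _).trans ?_
  have h {w : ι → ℂ} (hw : ∀ a, ‖w a‖ ≤ 1) (φ : ι → ℂ) :
      ∑ a, ‖w a * φ a‖ ^ 2 ≤ ∑ a, ‖φ a‖ ^ 2 := by
    refine Finset.sum_le_sum fun a _ => ?_
    rw [norm_mul]
    exact pow_le_pow_left₀ (by positivity)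
      (mul_le_of_le_one_left (norm_nonneg _) (hw a)) 2
  have h1 := h (w := fun a => star (u a)) (fun a => by rw [norm_star]; exact hu a) ψ
  have h2 := h hv φ
  gcongr

/-- Multiplication by a kernel that is `ε` times an average of kernels `u_y(a) v_y(a')` of modulus
at most one scales a Schur bound by `ε`. -/
lemma SchurBound.average_mul [Fintype Y] [Nonempty Y] {K : ι → ι → ℂ} {c : ℝ}
    (hK : SchurBound χ N K c) (hc : 0 ≤ c) (hN : 0 ≤ N) {ε : ℝ} (hε : 0 ≤ ε)
    {u v : Y → ι → ℂ} (hu : ∀ y a, ‖u y a‖ ≤ 1) (hv : ∀ y a, ‖v y a‖ ≤ 1) {L : ι → ι → ℂ}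
    (hL : ∀ a a', L a a' = (ε / Fintype.card Y : ℝ) * ∑ y, u y a * v y a') :
    SchurBound χ N (fun a a' => L a a' * K a a') (ε * c) := by
  intro ψ φ
  have hcard : (0 : ℝ) < Fintype.card Y := by exact_mod_cast Fintype.card_pos
  have hform (x : X) : ‖schurForm χ (fun a a' => L a a' * K a a') ψ φ x‖ ≤
      (ε / Fintype.card Y : ℝ) *
        ∑ y, ‖schurForm χ (fun a a' => u y a * v y a' * K a a') ψ φ x‖ := by
    simp only [hL, mul_assoc ((ε / Fintype.card Y : ℝ) : ℂ), Finset.sum_mul]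
    rw [schurForm_sum, norm_mul, Complex.norm_real, Real.norm_of_nonneg (by positivity)]
    gcongr
    exact norm_sum_le _ _
  refine (Finset.sum_le_sum fun x _ => hform x).trans ?_
  rw [← Finset.mul_sum, Finset.sum_comm]
  have hsum : ∑ y, ∑ x, ‖schurForm χ (fun a a' => u y a * v y a' * K a a') ψ φ x‖ ≤
      ∑ _y : Y, c * (N * ((∑ a, ‖ψ a‖ ^ 2 + ∑ a, ‖φ a‖ ^ 2) / 2)) :=
    Finset.sum_le_sum fun y _ => hK.diag_mul hc hN (hu y) (hv y) ψ φ
  refine (mul_le_mul_of_nonneg_left hsum (by positivity)).trans (le_of_eq ?_)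
  rw [Finset.sum_const, Finset.card_univ, nsmul_eq_mul]
  field_simp

/-- The bound `(1 + ε)^k - 1` for the difference between a product of `k` kernels `1 + L i` and the
trivial kernel, where each `L i` is `ε` times an average as in `SchurBound.average_mul`. -/
lemma SchurBound.prod_sub_one [Fintype Y] [Nonempty Y] {I : Type*}
    (hχ : ∀ φ : ι → ℂ, ∑ x, ‖∑ a, star (χ x a) * φ a‖ ^ 2 = N * ∑ a, ‖φ a‖ ^ 2)
    (hN : 0 ≤ N) {ε : ℝ} (hε : 0 ≤ ε)
    {u v : I → Y → ι → ℂ} (hu : ∀ i y a, ‖u i y a‖ ≤ 1) (hv : ∀ i y a, ‖v i y a‖ ≤ 1)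
    {L : I → ι → ι → ℂ}
    (hL : ∀ i a a', L i a a' = (ε / Fintype.card Y : ℝ) * ∑ y, u i y a * v i y a')
    (s : Finset I) :
    SchurBound χ N (fun a a' => ∏ i ∈ s, (1 + L i a a') - 1) ((1 + ε) ^ s.card - 1) := by
  classical
  induction s using Finset.induction_on with
  | empty => intro ψ φ; simp [schurForm]
  | insert i s hi ih =>
    have h0 : (0 : ℝ) ≤ (1 + ε) ^ s.card - 1 := sub_nonneg.2 (one_le_pow₀ (by linarith))
    have h := (ih.add (ih.average_mul h0 hN hε (hu i) (hv i) (hL i))).add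
      ((SchurBound.one hχ).average_mul zero_le_one hN hε (hu i) (hv i) (hL i))
    rw [Finset.card_insert_of_notMem hi]
    convert h using 1
    · funext a a'
      rw [Finset.prod_insert hi]
      ring
    · ring

/-- If the kernel `K` is closer than `1 / 2` to the trivial kernel, then no pair of orthonormal
vectors satisfies the Knill–Laflamme conditions for all the operators `K ∘ χ_x χ_x*`: for
`K = 1` these conditions force both vectors to have disjoint supports and equal moduli in
the basis `χ`. -/
theorem not_knillLaflamme_of_schurBound
    (hχ : ∀ φ : ι → ℂ, ∑ x, ‖∑ a, star (χ x a) * φ a‖ ^ 2 = N * ∑ a, ‖φ a‖ ^ 2)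
    (hN : 0 < N) {K : ι → ι → ℂ} {δ : ℝ} (hδ : δ < 1 / 2)
    (hK : SchurBound χ N (fun a a' => K a a' - 1) δ) {ψ φ : ι → ℂ}
    (hψ : ∑ a, ‖ψ a‖ ^ 2 = 1) (hφ : ∑ a, ‖φ a‖ ^ 2 = 1)
    (h1 : ∀ x, schurForm χ K ψ φ x = 0)
    (h2 : ∀ x, schurForm χ K ψ ψ x = schurForm χ K φ φ x) : False := by
  have hsplit (ψ φ : ι → ℂ) (x : X) : schurForm χ K ψ φ x =
      schurForm χ (fun a a' => K a a' - 1) ψ φ x + schurForm χ (fun _ _ => 1) ψ φ x := by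
    rw [← schurForm_add]; simp
  let p (x : X) : ℝ := ‖∑ a, star (χ x a) * ψ a‖
  let q (x : X) : ℝ := ‖∑ a, star (χ x a) * φ a‖
  have hpq (x) : p x * q x = ‖schurForm χ (fun a a' => K a a' - 1) ψ φ x‖ := by
    have h := h1 x
    rw [hsplit, schurForm_one] at h
    rw [eq_neg_of_add_eq_zero_left h, norm_neg, norm_mul, norm_star]
  have hdiff (x) : |p x ^ 2 - q x ^ 2| ≤ ‖schurForm χ (fun a a' => K a a' - 1) ψ ψ x‖ +
      ‖schurForm χ (fun a a' => K a a' - 1) φ φ x‖ := by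
    have hsq (z : ℂ) : star z * z = ((‖z‖ ^ 2 : ℝ) : ℂ) := by
      rw [← starRingEnd_apply, Complex.conj_mul']; norm_cast
    have h := h2 x
    rw [hsplit, hsplit, schurForm_one, schurForm_one, hsq, hsq] at h
    have h' : ((p x ^ 2 - q x ^ 2 : ℝ) : ℂ) = schurForm χ (fun a a' => K a a' - 1) φ φ x -
        schurForm χ (fun a a' => K a a' - 1) ψ ψ x := by
      simp only [p, q]
      push_cast at h ⊢
      linear_combination h
    rw [← Real.norm_eq_abs, ← Complex.norm_real, h', add_comm]
    exact norm_sub_le _ _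
  have hpt (x) : p x ^ 2 + q x ^ 2 ≤ |p x ^ 2 - q x ^ 2| + 2 * (p x * q x) := by
    have hp : 0 ≤ p x := norm_nonneg _
    have hq : 0 ≤ q x := norm_nonneg _
    rcases le_total (q x) (p x) with h | h
    · nlinarith [le_abs_self (p x ^ 2 - q x ^ 2)]
    · nlinarith [neg_abs_le (p x ^ 2 - q x ^ 2)]
  have hp := hχ ψ
  have hq := hχ φ
  have b1 := hK ψ φ
  have b2 := hK ψ ψ
  have b3 := hK φ φ
  have hsum : ∑ x, (p x ^ 2 + q x ^ 2) ≤ ∑ x,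
      ((‖schurForm χ (fun a a' => K a a' - 1) ψ ψ x‖ +
      ‖schurForm χ (fun a a' => K a a' - 1) φ φ x‖) +
        2 * ‖schurForm χ (fun a a' => K a a' - 1) ψ φ x‖) :=
    Finset.sum_le_sum fun x _ => by linarith [hpt x, hdiff x, hpq x]
  rw [Finset.sum_add_distrib, Finset.sum_add_distrib, Finset.sum_add_distrib, ← Finset.mul_sum,
    show ∑ x, p x ^ 2 = _ from hp, show ∑ x, q x ^ 2 = _ from hq] at hsum
  rw [hψ, hφ] at *
  nlinarith

end SchurBound

section Walsh

/-- The character table of the group of order four and exponent two. -/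
def hadamard : Matrix (Fin 4) (Fin 4) ℂ :=
  !![1, 1, 1, 1; 1, -1, 1, -1; 1, 1, -1, -1; 1, -1, -1, 1]

lemma star_hadamard (x a : Fin 4) : star (hadamard x a) = hadamard x a := by
  fin_cases x <;> fin_cases a <;> simp [hadamard]

lemma norm_hadamard (x a : Fin 4) : ‖hadamard x a‖ = 1 := by
  fin_cases x <;> fin_cases a <;> simp [hadamard]

lemma sum_hadamard_mul (a a' : Fin 4) :
    ∑ x, hadamard x a * hadamard x a' = if a = a' then 4 else 0 := by
  fin_cases a <;> fin_cases a' <;> simp [hadamard, Fin.sum_univ_four] <;> norm_num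

variable {n : ℕ}

/-- The product characters of `n` copies of the group of order four and exponent two. -/
def walsh (x a : Fin n → Fin 4) : ℂ := ∏ i, hadamard (x i) (a i)

lemma star_walsh (x a : Fin n → Fin 4) : star (walsh x a) = walsh x a := by
  simp only [walsh, star_prod, star_hadamard]

lemma sum_walsh_mul (a a' : Fin n → Fin 4) :
    ∑ x, walsh x a * walsh x a' = if a = a' then 4 ^ n else 0 := by
  simp only [walsh, ← Finset.prod_mul_distrib]
  rw [← Fintype.prod_sum (fun i x => hadamard x (a i) * hadamard x (a' i))]
  simp only [sum_hadamard_mul]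
  rw [Finset.prod_ite_zero]
  simp [funext_iff]

lemma parseval_walsh (φ : (Fin n → Fin 4) → ℂ) :
    ∑ x, ‖∑ a, star (walsh x a) * φ a‖ ^ 2 = (4 : ℝ) ^ n * ∑ a, ‖φ a‖ ^ 2 := by
  have hsq (z : ℂ) : ((‖z‖ ^ 2 : ℝ) : ℂ) = star z * z := by
    rw [← starRingEnd_apply, Complex.conj_mul']; norm_cast
  apply Complex.ofReal_injective
  rw [Complex.ofReal_sum, Complex.ofReal_mul, Complex.ofReal_sum]
  simp only [hsq, star_sum, star_mul', star_walsh, Finset.sum_mul_sum]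
  rw [Finset.sum_comm, Finset.mul_sum]
  refine Finset.sum_congr rfl fun a _ => ?_
  rw [Finset.sum_comm]
  calc _ = ∑ a', star (φ a) * φ a' * ∑ x, walsh x a * walsh x a' := by
        simp only [Finset.mul_sum]
        exact (Finset.sum_congr rfl fun a _ => Finset.sum_congr rfl fun a' _ => by ring)
    _ = _ := by simp [sum_walsh_mul, mul_comm]

/-- The kernel by which the space `𝔏_θ`, with `γ = exp (iθ/2)`, arises from `𝔏_0` as an entrywise
product. -/
def phaseMat (γ : ℂ) : Matrix (Fin 4) (Fin 4) ℂ :=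
  !![1, 1, γ, 1; 1, 1, 1, star γ; star γ, 1, 1, 1; 1, γ, 1, 1]

/-- The four entries of `phaseMat γ - 1` that need not vanish, one in each row. -/
def phaseDefect (γ : ℂ) : Fin 4 → ℂ := ![γ - 1, star γ - 1, star γ - 1, γ - 1]

lemma norm_phaseDefect (γ : ℂ) (a : Fin 4) : ‖phaseDefect γ a‖ = ‖γ - 1‖ := by
  have h : ‖star γ - 1‖ = ‖γ - 1‖ := by
    rw [← norm_star (γ - 1)]; simp
  fin_cases a <;> simp only [phaseDefect] <;> first | rfl | exact h

/-- The difference between `phaseMat γ` and the trivial kernel is supported on the graph of a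
permutation, whose indicator function is an average of products of characters. -/
lemma phaseMat_eq (γ : ℂ) (a a' : Fin 4) :
    phaseMat γ a a' = 1 + (‖γ - 1‖ / Fintype.card (Fin 4) : ℝ) *
      ∑ y, (phaseDefect γ a / ‖γ - 1‖ * hadamard y (![2, 3, 0, 1] a)) * hadamard y a' := by
  -- for `γ = 1` the quotient is `0 / 0 = 0`, and the identity still holds
  have h : phaseDefect γ a / ‖γ - 1‖ * ‖γ - 1‖ = phaseDefect γ a := by
    refine div_mul_cancel_of_imp fun h => ?_
    rw [← norm_eq_zero, norm_phaseDefect]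
    exact_mod_cast h
  simp only [mul_assoc]
  rw [← Finset.mul_sum, sum_hadamard_mul]
  have h' : phaseMat γ a a' = 1 + phaseDefect γ a * (if ![2, 3, 0, 1] a = a' then 1 else 0) := by
    fin_cases a <;> fin_cases a' <;> simp [phaseMat, phaseDefect]
  generalize phaseDefect γ a / ‖γ - 1‖ = t at h ⊢
  rw [h', ← h]
  push_cast
  split_ifs
  · simp; ring
  · simp

lemma schurBound_phaseMat (γ : ℂ) :
    SchurBound (walsh (n := n)) (4 ^ n) (fun a a' => ∏ i, phaseMat γ (a i) (a' i) - 1)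
      ((1 + ‖γ - 1‖) ^ n - 1) := by
  have h := SchurBound.prod_sub_one (χ := walsh (n := n)) (Y := Fin 4) (I := Fin n)
    parseval_walsh (by positivity) (norm_nonneg (γ - 1))
    (u := fun i y a => phaseDefect γ (a i) / ‖γ - 1‖ * hadamard y (![2, 3, 0, 1] (a i)))
    (v := fun i y a' => hadamard y (a' i)) (L := fun i a a' => phaseMat γ (a i) (a' i) - 1)
    (by
      intro i y a
      rw [norm_mul, norm_hadamard, mul_one, norm_div, norm_phaseDefect, Complex.norm_real,
        norm_norm]
      exact div_self_le_one _)
    (fun i y a => (norm_hadamard _ _).le)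
    (fun i a a' => by rw [phaseMat_eq, add_sub_cancel_left]) Finset.univ
  simpa only [add_sub_cancel, Finset.card_univ, Fintype.card_fin] using h

end Walsh

/-! ### Noncommutative graphs of tensor powers -/

section Graph

lemma tensorMat_eq_sum {A B : Type*} [Fintype B] {n d : ℕ} {K : Fin d → Matrix B A ℂ}
    {F : Fin n → Matrix A A ℂ}
    (hF : ∀ i, ∃ Y : Fin d × Fin d → ℂ, F i = ∑ p, Y p • ((K p.1)ᴴ * K p.2)) :
    ∃ Z : (Fin n → Fin d × Fin d) → ℂ, tensorMat F = ∑ p, Z p •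
      ((tensorMat fun i => K (p i).1)ᴴ * tensorMat fun i => K (p i).2) := by
  choose Y hY using hF
  refine ⟨fun p => ∏ i, Y i (p i), ?_⟩
  rw [funext hY, tensorMat_sum (fun i p => Y i p • ((K p.1)ᴴ * K p.2))]
  simp only [tensorMat_smul, conjTranspose_tensorMat, tensorMat_mul]

variable {A B : Type*} [Fintype A] [DecidableEq A] [Fintype B]

lemma IsNoncommutativeGraph.exists_kraus {Φ : MatMap A B} {L : Submodule ℂ (Matrix A A ℂ)}
    (h : IsNoncommutativeGraph Φ L) :
    ∃ (d : ℕ) (K : Fin d → Matrix B A ℂ), ∑ e, (K e)ᴴ * K e = 1 ∧ Φ = krausMap K ∧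
      (∀ e e', (K e)ᴴ * K e' ∈ L) ∧
      ∀ M ∈ L, ∃ Y : Fin d × Fin d → ℂ, M = ∑ p, Y p • ((K p.1)ᴴ * K p.2) := by
  obtain ⟨d, V, hV, rfl⟩ := h
  rw [isStinespring_iff] at hV
  refine ⟨d, krausOp V, hV.1, hV.2, fun e e' => ?_, ?_⟩
  · refine ⟨Matrix.single e e' 1, ?_⟩
    rw [dualMap_complementary_apply]
    simp [Matrix.single_apply, ite_and]
  · rintro _ ⟨Y, rfl⟩
    exact ⟨fun p => Y p.1 p.2, by rw [dualMap_complementary_apply, Fintype.sum_prod_type]⟩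

/-- On a code of dimension at least two of a tensor power, there is an orthonormal pair that
satisfies the Knill–Laflamme condition for all products of elements of the graph. -/
lemma IsCode.exists_orthonormal_pair_tensorPower {n : ℕ} {Φ : MatMap A B}
    {L : Submodule ℂ (Matrix A A ℂ)} (hΦ : IsNoncommutativeGraph Φ L)
    {H : Submodule ℂ (EuclideanSpace ℂ (Fin n → A))} (hH : IsCode (tensorPower n Φ) H)
    (hdim : 2 ≤ Module.finrank ℂ H) :
    ∃ ψ φ : (Fin n → A) → ℂ, star ψ ⬝ᵥ ψ = 1 ∧ star φ ⬝ᵥ φ = 1 ∧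
      ∀ F : Fin n → Matrix A A ℂ, (∀ i, F i ∈ L) →
        star ψ ⬝ᵥ (tensorMat F *ᵥ φ) = 0 ∧
        star ψ ⬝ᵥ (tensorMat F *ᵥ ψ) = star φ ⬝ᵥ (tensorMat F *ᵥ φ) := by
  obtain ⟨d, K, -, rfl, -, hL⟩ := hΦ.exists_kraus
  rw [tensorPower_krausMap] at hH
  obtain ⟨ψ, φ, hψ, hφ, h⟩ := hH.exists_orthonormal_pair _ hdim
  refine ⟨ψ, φ, hψ, hφ, fun F hF => ?_⟩
  obtain ⟨Z, hZ⟩ := tensorMat_eq_sum fun i => hL (F i) (hF i)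
  have h1 := fun p : Fin n → Fin d × Fin d => (h (fun i => (p i).1) fun i => (p i).2).1
  have h2 := fun p : Fin n → Fin d × Fin d => (h (fun i => (p i).1) fun i => (p i).2).2
  simp only [hZ, Matrix.sum_mulVec, Matrix.smul_mulVec, dotProduct_sum, dotProduct_smul, h1, h2]
  simp

end Graph

/-! ### No codes in few copies -/

section NShot

/-- The phase `γ = exp (iθ/2)` in the definition of `𝔏_θ`. -/
noncomputable def phase (θ : ℝ) : ℂ := Complex.exp (Complex.I / 2 * θ)

lemma phase_eq (θ : ℝ) : phase θ = Complex.exp (Complex.I * (θ / 2 : ℝ)) := by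
  rw [phase]; congr 1; push_cast; ring

lemma schurForm_walsh {n : ℕ} (γ : ℂ) (ψ φ : (Fin n → Fin 4) → ℂ) (x : Fin n → Fin 4) :
    schurForm walsh (fun a a' => ∏ i, phaseMat γ (a i) (a' i)) ψ φ x =
      star ψ ⬝ᵥ (tensorMat (fun i => Matrix.of fun a a' =>
        hadamard (x i) a * phaseMat γ a a' * hadamard (x i) a') *ᵥ φ) := by
  simp only [schurForm, star_walsh]
  simp only [dotProduct, Matrix.mulVec, tensorMat, Matrix.of_apply,
    Finset.prod_mul_distrib, Finset.mul_sum, walsh, Pi.star_apply]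
  exact Finset.sum_congr rfl fun a _ => Finset.sum_congr rfl fun a' _ => by ring

lemma hadamard_mem_graphSpace (θ : ℝ) (x : Fin 4) :
    (Matrix.of fun a a' => hadamard x a * phaseMat (phase θ) a a' * hadamard x a') ∈
      graphSpace θ := by
  refine ⟨1, hadamard x 1, hadamard x 2, hadamard x 3, phase θ, rfl, ?_⟩
  ext a a'
  fin_cases x <;> fin_cases a <;> fin_cases a' <;> simp [hadamard, phaseMat]

lemma one_add_norm_phase_sub_one_pow_lt {n : ℕ} (hn : 1 ≤ n) {θ : ℝ} (hθ : 0 < θ)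
    (hθn : θ ≤ 2 * Real.log (3 / 2) / n) : (1 + ‖phase θ - 1‖) ^ n - 1 < 1 / 2 := by
  have hn' : (0 : ℝ) < n := by exact_mod_cast hn
  have h1 : ‖phase θ - 1‖ ≤ θ / 2 := by
    rw [phase_eq]
    refine Real.norm_exp_I_mul_ofReal_sub_one_le.trans (le_of_eq ?_)
    rw [Real.norm_of_nonneg (by positivity)]
  have h2 : 1 + ‖phase θ - 1‖ < Real.exp (θ / 2) := by
    linarith [Real.add_one_lt_exp (x := θ / 2) (by positivity)]
  have h3 : (1 + ‖phase θ - 1‖) ^ n < Real.exp (θ / 2) ^ n :=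
    pow_lt_pow_left₀ h2 (by positivity) (by omega)
  have h4 : Real.exp (θ / 2) ^ n ≤ 3 / 2 := by
    rw [← Real.exp_nat_mul, ← Real.le_log_iff_exp_le (by norm_num)]
    rw [le_div_iff₀ hn'] at hθn
    linarith
  linarith

/-- For small `θ`, the `n`-th tensor power has no code of dimension two or more. -/
theorem finrank_le_one_of_isCode {n : ℕ} (hn : 1 ≤ n) {θ : ℝ} (hθ : 0 < θ)
    (hθn : θ ≤ 2 * Real.log (3 / 2) / n) {B : Type*} [Fintype B] {Φ : MatMap (Fin 4) B}
    (hΦ : IsNoncommutativeGraph Φ (graphSpace θ))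
    {H : Submodule ℂ (EuclideanSpace ℂ (Fin n → Fin 4))} (hH : IsCode (tensorPower n Φ) H) :
    Module.finrank ℂ H ≤ 1 := by
  by_contra! hdim
  obtain ⟨ψ, φ, hψ, hφ, h⟩ := hH.exists_orthonormal_pair_tensorPower hΦ hdim
  have hnorm {ψ : (Fin n → Fin 4) → ℂ} (hψ : star ψ ⬝ᵥ ψ = 1) : ∑ a, ‖ψ a‖ ^ 2 = 1 := by
    have hsq (z : ℂ) : star z * z = ((‖z‖ ^ 2 : ℝ) : ℂ) := by
      rw [← starRingEnd_apply, Complex.conj_mul']; norm_cast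
    simp only [dotProduct, Pi.star_apply, hsq] at hψ
    exact_mod_cast hψ
  refine not_knillLaflamme_of_schurBound parseval_walsh (by positivity)
    (one_add_norm_phase_sub_one_pow_lt hn hθ hθn) (schurBound_phaseMat (phase θ))
    (hnorm hψ) (hnorm hφ) (fun x => ?_) fun x => ?_
  · rw [schurForm_walsh]
    exact (h _ fun i => hadamard_mem_graphSpace θ (x i)).1
  · rw [schurForm_walsh, schurForm_walsh]
    exact (h _ fun i => hadamard_mem_graphSpace θ (x i)).2

end NShot

/-! ### Orthogonal codes in `m` copies -/

section Codes

variable {m : ℕ}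

/-- The basis vector with label `k` in each factor, where the order of the four labels is reversed
in the factors selected by `s`. -/
def label (s : Fin m → Bool) (k : Fin 4) : Fin m → Fin 4 := fun i => if s i then k.rev else k

lemma label_eq_iff (hm : 1 ≤ m) (s t : Fin m → Bool) (k l : Fin 4) :
    label s k = label t l ↔ (k = l ∧ s = t) ∨ (k = l.rev ∧ s = fun i => !t i) := by
  have h : ∀ (b c : Bool) (k l : Fin 4), (if b then k.rev else k) = (if c then l.rev else l) ↔
      (k = l ∧ b = c) ∨ (k = l.rev ∧ b = !c) := by decide
  have hr : ∀ l : Fin 4, l ≠ l.rev := by decide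
  simp only [funext_iff, label, h]
  constructor
  · intro hi
    rcases hi ⟨0, hm⟩ with h0 | h0
    · exact .inl ⟨h0.1, fun i => ((hi i).resolve_right fun h1 => hr l (h0.1 ▸ h1.1)).2⟩
    · exact .inr ⟨h0.1, fun i => ((hi i).resolve_left fun h1 => hr l (h1.1 ▸ h0.1)).2⟩
  · rintro (⟨hk, hs⟩ | ⟨hk, hs⟩) i
    · exact .inl ⟨hk, hs i⟩
    · exact .inr ⟨hk, hs i⟩

/-- The two orthonormal vectors `(e_0 + i e_1) / √2` and `(e_2 + i e_3) / √2` that span a code, where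
`e_k` is the basis vector `label s k`. -/
noncomputable def codeVec (s : Fin m → Bool) (j : Fin 2) : (Fin m → Fin 4) → ℂ :=
  (Real.sqrt 2 : ℂ)⁻¹ • (Pi.single (label s (![0, 2] j)) 1 +
    Complex.I • Pi.single (label s (![1, 3] j)) 1)

lemma star_codeVec_dotProduct_mulVec (s t : Fin m → Bool) (j l : Fin 2)
    (M : Matrix (Fin m → Fin 4) (Fin m → Fin 4) ℂ) :
    star (codeVec s j) ⬝ᵥ (M *ᵥ codeVec t l) =
      (M (label s (![0, 2] j)) (label t (![0, 2] l)) +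
        Complex.I * M (label s (![0, 2] j)) (label t (![1, 3] l)) -
        Complex.I * M (label s (![1, 3] j)) (label t (![0, 2] l)) +
        M (label s (![1, 3] j)) (label t (![1, 3] l))) / 2 := by
  have hs : (Real.sqrt 2 : ℂ)⁻¹ * (Real.sqrt 2 : ℂ)⁻¹ = 1 / 2 := by
    simp only [← mul_inv, ← Complex.ofReal_mul]
    norm_num
  have hstar : star (codeVec s j) = (Real.sqrt 2 : ℂ)⁻¹ • (Pi.single (label s (![0, 2] j)) 1 -
      Complex.I • Pi.single (label s (![1, 3] j)) 1) := by
    funext a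
    simp [codeVec, Pi.single_apply, apply_ite (starRingEnd ℂ), sub_eq_add_neg]
    split_ifs <;> ring
  rw [hstar, codeVec]
  simp only [smul_dotProduct, Matrix.mulVec_smul, Matrix.mulVec_add, dotProduct_smul,
    sub_dotProduct, dotProduct_add, Matrix.mulVec_single_one, single_one_dotProduct,
    smul_eq_mul, Matrix.col_apply]
  linear_combination (M (label s (![0, 2] j)) (label t (![0, 2] l)) +
        Complex.I * M (label s (![0, 2] j)) (label t (![1, 3] l)) -
        Complex.I * M (label s (![1, 3] j)) (label t (![0, 2] l)) +
        M (label s (![1, 3] j)) (label t (![1, 3] l))) * hs -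
        (Real.sqrt 2 : ℂ)⁻¹ * (Real.sqrt 2 : ℂ)⁻¹ *
          M (label s (![1, 3] j)) (label t (![1, 3] l)) * Complex.I_mul_I

lemma star_codeVec_dotProduct (hm : 1 ≤ m) (s t : Fin m → Bool) (j l : Fin 2) :
    star (codeVec s j) ⬝ᵥ codeVec t l = if s = t ∧ j = l then 1 else 0 := by
  rw [← Matrix.one_mulVec (codeVec t l), star_codeVec_dotProduct_mulVec]
  simp only [Matrix.one_apply, label_eq_iff hm]
  by_cases hst : s = t
  · have h : ¬ t = fun i => !t i := fun h => by simpa using congrFun h ⟨0, hm⟩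
    fin_cases j <;> fin_cases l <;> simp [hst, h]
  · by_cases hst' : s = fun i => !t i <;>
    fin_cases j <;> fin_cases l <;> simp [hst, hst']

lemma orthonormal_codeVec (hm : 1 ≤ m) (s : Fin m → Bool) :
    Orthonormal ℂ fun j => (WithLp.toLp 2 (codeVec s j) : EuclideanSpace ℂ (Fin m → Fin 4)) := by
  rw [orthonormal_iff_ite]
  intro j l
  rw [EuclideanSpace.inner_eq_star_dotProduct, dotProduct_comm]
  simp [star_codeVec_dotProduct hm]

/-- The two-dimensional code spanned by `codeVec s 0` and `codeVec s 1`. -/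
noncomputable def codeSpace (s : Fin m → Bool) : Submodule ℂ (EuclideanSpace ℂ (Fin m → Fin 4)) :=
  Submodule.span ℂ (Set.range fun j => WithLp.toLp 2 (codeVec s j))

lemma finrank_codeSpace (hm : 1 ≤ m) (s : Fin m → Bool) :
    Module.finrank ℂ (codeSpace s) = 2 := by
  rw [codeSpace, finrank_span_eq_card (orthonormal_codeVec hm s).linearIndependent,
    Fintype.card_fin]

lemma codeSpace_isOrtho (hm : 1 ≤ m) {s t : Fin m → Bool} (h : s ≠ t) :
    codeSpace s ⟂ codeSpace t := by
  rw [codeSpace, codeSpace, Submodule.isOrtho_span]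
  rintro _ ⟨j, rfl⟩ _ ⟨l, rfl⟩
  rw [EuclideanSpace.inner_eq_star_dotProduct, dotProduct_comm]
  simp [star_codeVec_dotProduct hm, h]

/-- Elements of `𝔏_θ` are invariant under simultaneous reversal of the order of rows and
columns. -/
lemma apply_rev_rev_of_mem_graphSpace {θ : ℝ} {M : Matrix (Fin 4) (Fin 4) ℂ}
    (hM : M ∈ graphSpace θ) (k l : Fin 4) : M k.rev l.rev = M k l := by
  obtain ⟨a, b, c, d, γ, -, rfl⟩ := hM
  fin_cases k <;> fin_cases l <;> simp [Fin.rev]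

lemma tensorMat_label {θ : ℝ} {F : Fin m → Matrix (Fin 4) (Fin 4) ℂ}
    (hF : ∀ i, F i ∈ graphSpace θ) (s : Fin m → Bool) (k l : Fin 4) :
    tensorMat F (label s k) (label s l) = ∏ i, F i k l := by
  simp only [tensorMat, Matrix.of_apply, label]
  refine Finset.prod_congr rfl fun i _ => ?_
  split_ifs
  · exact apply_rev_rev_of_mem_graphSpace (hF i) k l
  · rfl

/-- The Knill–Laflamme condition for the code vectors. The off-diagonal matrix elements are
proportional to `γ ^ m + star γ ^ m`; the other terms cancel in pairs. -/
lemma codeVec_knillLaflamme {θ : ℝ} (hθ : phase θ ^ m + star (phase θ) ^ m = 0)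
    {F : Fin m → Matrix (Fin 4) (Fin 4) ℂ} (hF : ∀ i, F i ∈ graphSpace θ) (s : Fin m → Bool)
    (j l : Fin 2) :
    star (codeVec s j) ⬝ᵥ (tensorMat F *ᵥ codeVec s l) =
      if j = l then ∏ i, F i 0 0 else 0 := by
  rw [star_codeVec_dotProduct_mulVec]
  simp only [tensorMat_label hF]
  choose a b c d γ hγ hF' using hF
  obtain rfl : γ = fun _ => phase θ := funext hγ
  simp only [hF']
  fin_cases j <;> fin_cases l <;>
    simp only [Fin.zero_eta, Fin.mk_one, Matrix.cons_val_zero, Matrix.cons_val_one, Matrix.of_apply,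
      Matrix.cons_val, if_true, Fin.isValue, zero_ne_one, one_ne_zero, if_false,
      Finset.prod_mul_distrib, Finset.prod_const, Finset.card_univ, Fintype.card_fin]
  · ring
  · linear_combination (∏ i, c i) / 2 * hθ
  · linear_combination (∏ i, c i) / 2 * hθ
  · ring

theorem isCode_codeSpace (hm : 1 ≤ m) {θ : ℝ} (hθ : phase θ ^ m + star (phase θ) ^ m = 0)
    {B : Type*} [Fintype B] {Φ : MatMap (Fin 4) B}
    (hΦ : IsNoncommutativeGraph Φ (graphSpace θ)) (s : Fin m → Bool) :
    IsCode (tensorPower m Φ) (codeSpace s) := by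
  obtain ⟨d, K, hK, rfl, hmem, -⟩ := hΦ.exists_kraus
  rw [tensorPower_krausMap]
  refine isCode_of_knillLaflamme _ (sum_conjTranspose_mul_tensorMat K hK) _
    (fun i j => by simp [star_codeVec_dotProduct hm])
    (fun e e' => ∏ i, ((K (e i))ᴴ * K (e' i)) 0 0) fun i j e e' => ?_
  rw [conjTranspose_tensorMat, tensorMat_mul]
  exact codeVec_knillLaflamme hθ (fun i => hmem _ _) s i j

lemma phase_pi_div_pow_add (hm : 1 ≤ m) :
    phase (Real.pi / m) ^ m + star (phase (Real.pi / m)) ^ m = 0 := by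
  have h : phase (Real.pi / m) ^ m = Complex.I := by
    have hm' : (m : ℂ) ≠ 0 := by exact_mod_cast (by omega : m ≠ 0)
    rw [phase, ← Complex.exp_nat_mul]
    refine Eq.trans (congrArg _ ?_) Complex.exp_pi_div_two_mul_I
    push_cast
    field_simp
  rw [← star_pow, h]
  simp

end Codes

/-! ### Capacities -/

section Capacity

variable {A B : Type*} [Fintype A] [DecidableEq A] [Fintype B]

lemma oneShotCapacity_eq_zero {Φ : MatMap A B}
    (h : ∀ H : Submodule ℂ (EuclideanSpace ℂ A), IsCode Φ H → Module.finrank ℂ H ≤ 1) :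
    oneShotCapacity Φ = 0 := by
  simp only [oneShotCapacity, ENNReal.iSup_eq_zero]
  rintro H ⟨-, hH⟩
  rcases Nat.le_one_iff_eq_zero_or_eq_one.1 (h H hH) with h0 | h0 <;> simp [h0]

lemma one_le_oneShotCapacity {Φ : MatMap A B} {H : Submodule ℂ (EuclideanSpace ℂ A)}
    (hH : IsCode Φ H) (hdim : Module.finrank ℂ H = 2) : 1 ≤ oneShotCapacity Φ := by
  refine le_trans (by simp [hdim]) (le_iSup₂ (f := fun (H : Submodule ℂ (EuclideanSpace ℂ A))
    (_ : H ≠ ⊥ ∧ IsCode Φ H) => ENNReal.ofReal (Real.logb 2 (Module.finrank ℂ H))) H ⟨?_, hH⟩)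
  rintro rfl
  simp at hdim

lemma oneShotCapacity_div_le_zeroErrorCapacity (Φ : MatMap A B) {m : ℕ} (hm : 1 ≤ m) :
    oneShotCapacity (tensorPower m Φ) / m ≤ zeroErrorCapacity Φ :=
  le_iSup₂ (f := fun (n : ℕ) (_ : 1 ≤ n) => oneShotCapacity (tensorPower n Φ) / n) m hm

end Capacity

/-! ### A channel with the given graph -/

section Existence

variable {A B : Type*} [Fintype A] [Fintype B] {d : ℕ}

/-- The isometry `x ↦ ∑ e, C e x ⊗ |e⟩ ⊗ |e⟩`, where the first two factors, identified with `ℂ^B`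
by `σ`, are the output and the last one is the environment. -/
def measureIsometry (σ : B ≃ Fin d × A) (C : Fin d → Matrix A A ℂ) :
    Matrix (B × Fin d) A ℂ :=
  Matrix.of fun p a => if (σ p.1).1 = p.2 then C p.2 (σ p.1).2 a else 0

lemma conjTranspose_mul_krausOp_measureIsometry (σ : B ≃ Fin d × A) (C : Fin d → Matrix A A ℂ)
    (e e' : Fin d) :
    (krausOp (measureIsometry σ C) e)ᴴ * krausOp (measureIsometry σ C) e' =
      if e = e' then (C e)ᴴ * C e else 0 := by
  ext a a'
  simp only [Matrix.mul_apply, Matrix.conjTranspose_apply, krausOp, measureIsometry,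
    Matrix.of_apply]
  rw [Equiv.sum_comp σ fun q : Fin d × A => star (if q.1 = e then C e q.2 a else 0) *
    (if q.1 = e' then C e' q.2 a' else 0), Fintype.sum_prod_type]
  rcases eq_or_ne e e' with rfl | h
  · rw [Finset.sum_eq_single e] <;> simp +contextual [Matrix.mul_apply]
  · rw [if_neg h, Matrix.zero_apply]
    refine Finset.sum_eq_zero fun i _ => Finset.sum_eq_zero fun b _ => ?_
    by_cases hi : i = e
    · simp [hi, h]
    · simp [hi]

/-- The effects `(C e)* C e` of a measurement span the noncommutative graph of some channel, namely
of the complement of a channel that measures and keeps only the outcome. -/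
lemma exists_channel_of_effects [DecidableEq A] (σ : B ≃ Fin d × A) (C : Fin d → Matrix A A ℂ)
    (hC : ∑ e, (C e)ᴴ * C e = 1) (L : Submodule ℂ (Matrix A A ℂ))
    (hL : ∀ M, M ∈ L ↔ ∃ y : Fin d → ℂ, M = ∑ e, y e • ((C e)ᴴ * C e)) :
    ∃ Φ : MatMap A B, IsChannel Φ ∧ IsNoncommutativeGraph Φ L := by
  have hK : ∑ e, (krausOp (measureIsometry σ C) e)ᴴ * krausOp (measureIsometry σ C) e = 1 := by
    simpa only [conjTranspose_mul_krausOp_measureIsometry, if_true] using hC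
  refine ⟨krausMap (krausOp (measureIsometry σ C)), krausMap_isChannel _ hK, d,
    measureIsometry σ C, (isStinespring_iff _ _).2 ⟨hK, rfl⟩, ?_⟩
  ext M
  simp only [hL, LinearMap.mem_range, dualMap_complementary_apply,
    conjTranspose_mul_krausOp_measureIsometry, smul_ite, smul_zero, Finset.sum_ite_eq,
    Finset.mem_univ, if_true]
  constructor
  · rintro ⟨y, rfl⟩
    exact ⟨Matrix.diagonal y, by simp⟩
  · rintro ⟨Y, rfl⟩
    exact ⟨fun e => Y e e, rfl⟩

/-- The general element of `𝔏_θ`, with `γ = exp (iθ/2)`. -/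
def graphMat (γ a b c d : ℂ) : Matrix (Fin 4) (Fin 4) ℂ :=
  !![a, b, γ * c, d;
     b, a, d, star γ * c;
     star γ * c, d, a, b;
     d, γ * c, b, a]

/-- The three Hermitian unitaries which together with the identity form a basis of `𝔏_θ`. -/
def graphUnitary (γ : ℂ) : Fin 3 → Matrix (Fin 4) (Fin 4) ℂ :=
  ![graphMat γ 0 1 0 0, graphMat γ 0 0 1 0, graphMat γ 0 0 0 1]

lemma graphMat_eq (γ a b c d : ℂ) :
    graphMat γ a b c d = a • (1 : Matrix (Fin 4) (Fin 4) ℂ) + b • graphUnitary γ 0 +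
      c • graphUnitary γ 1 + d • graphUnitary γ 2 := by
  ext i j
  fin_cases i <;> fin_cases j <;> simp [graphMat, graphUnitary, mul_comm]

lemma conjTranspose_graphUnitary (γ : ℂ) (k : Fin 3) : (graphUnitary γ k)ᴴ = graphUnitary γ k := by
  ext i j
  fin_cases k <;> fin_cases i <;> fin_cases j <;> simp [graphMat, graphUnitary]

lemma graphUnitary_mul_self {γ : ℂ} (hγ : star γ * γ = 1) (k : Fin 3) :
    graphUnitary γ k * graphUnitary γ k = 1 := by
  have hγ' : γ * star γ = 1 := by rw [mul_comm, hγ]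
  simp only [← starRingEnd_apply] at hγ hγ'
  ext i j
  fin_cases k <;> fin_cases i <;> fin_cases j <;>
    simp [graphMat, graphUnitary, Matrix.mul_apply, Fin.sum_univ_four, hγ, hγ']

lemma mem_graphSpace_iff (θ : ℝ) (M : Matrix (Fin 4) (Fin 4) ℂ) :
    M ∈ graphSpace θ ↔ ∃ a b c d, M = graphMat (phase θ) a b c d := by
  constructor
  · rintro ⟨a, b, c, d, _, rfl, rfl⟩
    exact ⟨a, b, c, d, rfl⟩
  · rintro ⟨a, b, c, d, rfl⟩
    exact ⟨a, b, c, d, _, rfl, rfl⟩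

lemma star_phase_mul_phase (θ : ℝ) : star (phase θ) * phase θ = 1 := by
  rw [← starRingEnd_apply, Complex.conj_mul', phase_eq, mul_comm Complex.I,
    Complex.norm_exp_ofReal_mul_I]
  simp

/-- Measurement operators with effects `(1 ± W) / 6`, where `W` runs over the three unitaries
`graphUnitary γ k`. -/
noncomputable def graphMeasure (γ : ℂ) : Fin 6 → Matrix (Fin 4) (Fin 4) ℂ :=
  ![(Real.sqrt 12 : ℂ)⁻¹ • (1 + graphUnitary γ 0), (Real.sqrt 12 : ℂ)⁻¹ • (1 - graphUnitary γ 0),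
    (Real.sqrt 12 : ℂ)⁻¹ • (1 + graphUnitary γ 1), (Real.sqrt 12 : ℂ)⁻¹ • (1 - graphUnitary γ 1),
    (Real.sqrt 12 : ℂ)⁻¹ • (1 + graphUnitary γ 2), (Real.sqrt 12 : ℂ)⁻¹ • (1 - graphUnitary γ 2)]

lemma conjTranspose_mul_self_of_involution [DecidableEq A] {W : Matrix A A ℂ} (hW : Wᴴ = W)
    (hWW : W * W = 1) :
    ((Real.sqrt 12 : ℂ)⁻¹ • (1 + W))ᴴ * ((Real.sqrt 12 : ℂ)⁻¹ • (1 + W)) =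
      (1 / 6 : ℂ) • (1 + W) := by
  have hs : star (Real.sqrt 12 : ℂ)⁻¹ * (Real.sqrt 12 : ℂ)⁻¹ = 1 / 12 := by
    rw [← starRingEnd_apply, map_inv₀, Complex.conj_ofReal, ← mul_inv, ← Complex.ofReal_mul]
    norm_num
  rw [Matrix.conjTranspose_smul, Matrix.conjTranspose_add, Matrix.conjTranspose_one, hW,
    smul_mul_smul_comm, hs, add_mul, one_mul, mul_add, mul_one, hWW]
  module

lemma sum_smul_effect {γ : ℂ} (hγ : star γ * γ = 1) (y : Fin 6 → ℂ) :
    ∑ e, y e • ((graphMeasure γ e)ᴴ * graphMeasure γ e) =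
      graphMat γ ((∑ e, y e) / 6) ((y 0 - y 1) / 6) ((y 2 - y 3) / 6) ((y 4 - y 5) / 6) := by
  have hp (k : Fin 3) := conjTranspose_mul_self_of_involution (conjTranspose_graphUnitary γ k)
    (graphUnitary_mul_self hγ k)
  have hm (k : Fin 3) := conjTranspose_mul_self_of_involution (W := -graphUnitary γ k)
    (by rw [Matrix.conjTranspose_neg, conjTranspose_graphUnitary])
    (by rw [neg_mul_neg, graphUnitary_mul_self hγ])
  simp only [← sub_eq_add_neg] at hm
  rw [graphMat_eq]
  simp only [Fin.sum_univ_six, graphMeasure, Matrix.cons_val, hp, hm]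
  module

/-- The space `𝔏_θ` is the noncommutative graph of a channel. -/
theorem exists_channel_graphSpace (θ : ℝ) :
    ∃ (d : ℕ) (Φ : MatMap (Fin 4) (Fin d)), IsChannel Φ ∧
      IsNoncommutativeGraph Φ (graphSpace θ) := by
  have hγ := star_phase_mul_phase θ
  refine ⟨6 * 4, exists_channel_of_effects finProdFinEquiv.symm (graphMeasure (phase θ)) ?_ _
    fun M => ?_⟩
  · have h := sum_smul_effect hγ fun _ => 1
    simp only [one_smul] at h
    rw [h, graphMat_eq]
    simp
  · simp only [mem_graphSpace_iff, sum_smul_effect hγ]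
    constructor
    · rintro ⟨a, b, c, d, rfl⟩
      -- for each unitary `W`, the difference of the effects `(1 ± W) / 6` is `W / 3`
      refine ⟨![a + 3 * b, a - 3 * b, a + 3 * c, a - 3 * c, a + 3 * d, a - 3 * d], ?_⟩
      simp only [Fin.sum_univ_six, Matrix.cons_val]
      congr 1 <;> ring
    · rintro ⟨y, rfl⟩
      exact ⟨_, _, _, _, rfl⟩

end Existence

end ZeroError

theorem corollary1 (n m : ℕ) (hn : 1 ≤ n) (hm : 1 ≤ m)
    (hnm : Real.pi / m ≤ 2 * Real.log (3 / 2) / n) :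
    (∃ (d : ℕ) (Φ : ZeroError.MatMap (Fin 4) (Fin d)), ZeroError.IsChannel Φ ∧
      ZeroError.IsNoncommutativeGraph Φ (ZeroError.graphSpace (Real.pi / m))) ∧
    ∀ (B : Type*) [Fintype B] (Φ : ZeroError.MatMap (Fin 4) B),
      ZeroError.IsChannel Φ →
      ZeroError.IsNoncommutativeGraph Φ (ZeroError.graphSpace (Real.pi / m)) →
      ZeroError.oneShotCapacity (ZeroError.tensorPower n Φ) = 0 ∧
      1 ≤ ZeroError.oneShotCapacity (ZeroError.tensorPower m Φ) ∧
      1 / (m : ℝ≥0∞) ≤ ZeroError.zeroErrorCapacity Φ ∧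
      ∃ C : Fin (2 ^ m) → Submodule ℂ (EuclideanSpace ℂ (Fin m → Fin 4)),
        (∀ i, Module.finrank ℂ (C i) = 2 ∧
          ZeroError.IsCode (ZeroError.tensorPower m Φ) (C i)) ∧
        Pairwise fun i j => C i ⟂ C j := by
  refine ⟨ZeroError.exists_channel_graphSpace _, fun B _ Φ _ hΦ => ?_⟩
  have hθ : 0 < Real.pi / m := div_pos Real.pi_pos (by exact_mod_cast hm)
  have hcode := ZeroError.isCode_codeSpace hm (ZeroError.phase_pi_div_pow_add hm) hΦ
  have hone : 1 ≤ ZeroError.oneShotCapacity (ZeroError.tensorPower m Φ) :=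
    ZeroError.one_le_oneShotCapacity (hcode fun _ => false) (ZeroError.finrank_codeSpace hm _)
  refine ⟨ZeroError.oneShotCapacity_eq_zero fun H hH =>
    ZeroError.finrank_le_one_of_isCode hn hθ hnm hΦ hH, hone,
    le_trans (ENNReal.div_le_div_right hone _)
      (ZeroError.oneShotCapacity_div_le_zeroErrorCapacity Φ hm), ?_⟩
  let σ : Fin (2 ^ m) ≃ (Fin m → Bool) := (Fintype.equivFinOfCardEq (by simp)).symm
  exact ⟨fun i => ZeroError.codeSpace (σ i),
    fun i => ⟨ZeroError.finrank_codeSpace hm _, hcode _⟩,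
    fun i j hij => ZeroError.codeSpace_isOrtho hm (σ.injective.ne hij)⟩
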